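/- Conventions. A simplicial complex $\Delta$ is a finite collection of finite sets closed under taking subsets; $V(\Delta)$ is its vertex set, $G(\Delta)$ its graph (1-skeleton), its facets are its inclusion-maximal faces, and $\Delta[U]=\{F\in\Delta : F\subseteq U\}$ for $U\subseteq V(\Delta)$. Let $\Gamma$ be an abelian group and fix a total order on the vertices. A $(d-1)$-chain is a finite formal sum $c=\sum_F a_F F$ of $d$-element sets with coefficients $a_F\in\Gamma$; its boundary is $\partial c=\sum_F a_F\sum_{j=1}^{d}(-1)^j F\setminus\{x_j\}$, where $F=\{x_1<\dots<x_d\}$; it is a cycle if $\partial c=0$. A subchain of $c$ is a chain $\sum_F b_F F$ with $b_F\in\{a_F,0\}$ for every $F$. A cycle $c$ is minimal if its only subchains that are cycles are $c$ and $0$. A minimal $(d-1)$-cycle complex (over $\Gamma$) is a simplicial complex that consists of all subsets of a single $d$-element set, or of all subsets of the sets $F$ with $a_F\ne 0$ for some nonzero minimal $(d-1)$-cycle $c=\sum_F a_F F$. Such a complex is balanced if $G(\Delta)$ has a proper colouring $\kappa:V(\Delta)\to\{1,\dots,d\}$; for $T\subseteq\{1,\dots,d\}$ the $T$-rank-selected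 subcomplex is then $\Delta_T=\Delta[\kappa^{-1}(T)]$. A set $U\subseteq V(\Delta)$ is $(\ge k)$-transversal if $|U\cap F|\ge k$ for every facet $F$ of $\Delta$. A graph $G$ is rigid in $\mathbb{R}^k$ if there is a map $p:V(G)\to\mathbb{R}^k$ such that every $q:V(G)\to\mathbb{R}^k$ with $(p(i)-p(j))\cdot(q(i)-q(j))=0$ for all edges $ij$ of $G$ has the form $q(i)=Sp(i)+t$ $(i\in V(G))$ for some skew-symmetric matrix $S$ and some $t\in\mathbb{R}^k$. Theorem. Let $d\ge 3$ and let $\Delta$ be a minimal $(d-1)$-cycle complex over an abelian group $\Gamma$. (1) If $\Delta$ is balanced, then for every proper colouring $\kappa:V(\Delta)\to\{1,\dots,d\}$ of $G(\Delta)$ and every $T\subseteq\{1,\dots,d\}$ with $|T|\ge 3$, the graph $G(\Delta_T)$ is rigid in $\mathbb{R}^{|T|}$. (2) Whether or not $\Delta$ is balanced, for every integer $k$ with $3\le k\le d$ and every $(\ge k)$-transversal set $U\subseteq V(\Delta)$, the graph $G(\Delta[U])$ is rigid in $\mathbb{R}^k$. -/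

import Mathlib

open scoped Matrix

section Rigidity

/-- `q` is an infinitesimal motion of the framework `(G, p)` in `ℝ^d`. -/
def IsInfinitesimalMotion {W : Type*} {d : ℕ} (G : SimpleGraph W) (p q : W → Fin d → ℝ) : Prop :=
  ∀ i j, G.Adj i j → (p i - p j) ⬝ᵥ (q i - q j) = 0

/-- `q` is a trivial motion of the configuration `p`: `q i = S (p i) + t` for a skew-symmetric
matrix `S` and a vector `t`. -/
def IsTrivialMotion {W : Type*} {d : ℕ} (p q : W → Fin d → ℝ) : Prop :=
  ∃ (S : Matrix (Fin d) (Fin d) ℝ) (t : Fin d → ℝ), Sᵀ = -S ∧ ∀ i, q i = S *ᵥ p i + t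

/-- The framework `(G, p)` is infinitesimally rigid in `ℝ^d`. -/
def IsInfinitesimallyRigid {W : Type*} {d : ℕ} (G : SimpleGraph W) (p : W → Fin d → ℝ) : Prop :=
  ∀ q : W → Fin d → ℝ, IsInfinitesimalMotion G p q → IsTrivialMotion p q

/-- The graph `G` is rigid in `ℝ^d`: some framework on `G` in `ℝ^d` is infinitesimally rigid. -/
def SimpleGraph.IsRigid {W : Type*} (G : SimpleGraph W) (d : ℕ) : Prop :=
  ∃ p : W → Fin d → ℝ, IsInfinitesimallyRigid G p

end Rigidity

/-! Simplicial complexes are Mathlib's `PreAbstractSimplicialComplex V`: the vertices are the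
`v : V` such that `{v}` is a face, and the empty face is left implicit. Every complex to which the
results apply is spanned by finitely many finite sets, hence is finite. -/

namespace PreAbstractSimplicialComplex

variable {V : Type*}

/-- The simplicial complex spanned by a collection of finite sets. -/
def spannedBy (S : Set (Finset V)) : PreAbstractSimplicialComplex V where
  faces := {G | G.Nonempty ∧ ∃ F ∈ S, G ⊆ F}
  isRelLowerSet_faces := by
    rintro G ⟨hG, F, hF, hGF⟩
    exact ⟨hG, fun H hHG hH => ⟨hH, F, hF, hHG.trans hGF⟩⟩

/-- The vertex set `V(Δ)`. -/
def vertexSet (Δ : PreAbstractSimplicialComplex V) : Set V :=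
  {v | {v} ∈ Δ.faces}

/-- The graph (1-skeleton) `G(Δ)`, with vertex set exactly `V(Δ)`. -/
def graph [DecidableEq V] (Δ : PreAbstractSimplicialComplex V) : SimpleGraph Δ.vertexSet where
  Adj u v := (u : V) ≠ v ∧ {(u : V), (v : V)} ∈ Δ.faces
  symm := ⟨fun u v h => ⟨h.1.symm, by rw [Finset.pair_comm]; exact h.2⟩⟩
  loopless := ⟨fun _ h => h.1 rfl⟩

/-- The restriction `Δ[U]` of `Δ` to `U`. -/
def restrict (Δ : PreAbstractSimplicialComplex V) (U : Set V) :
    PreAbstractSimplicialComplex V where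
  faces := {F | F ∈ Δ.faces ∧ (F : Set V) ⊆ U}
  isRelLowerSet_faces := by
    rintro G ⟨hG, hGU⟩
    refine ⟨(Δ.isRelLowerSet_faces hG).1, fun H hHG hH => ⟨?_, ?_⟩⟩
    · exact (Δ.isRelLowerSet_faces hG).2 hHG hH
    · exact (Finset.coe_subset.mpr hHG).trans hGU

/-- A facet is a face that is maximal under inclusion. -/
def IsFacet (Δ : PreAbstractSimplicialComplex V) (F : Finset V) : Prop :=
  Maximal (fun G => G ∈ Δ.faces) F

/-- `U ⊆ V(Δ)` is `(≥ k)`-transversal: `|U ∩ F| ≥ k` for every facet `F`. -/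
def IsTransversal (Δ : PreAbstractSimplicialComplex V) (k : ℕ) (U : Set V) : Prop :=
  U ⊆ Δ.vertexSet ∧ ∀ F : Finset V, Δ.IsFacet F → k ≤ (U ∩ (F : Set V)).ncard

/-- The `T`-rank-selected subcomplex `Δ_T = Δ[κ⁻¹(T)]` for a proper colouring `κ` of `Δ`
with `d` colours. -/
def rankSelected [DecidableEq V] (Δ : PreAbstractSimplicialComplex V) {d : ℕ}
    (κ : Δ.graph.Coloring (Fin d)) (T : Finset (Fin d)) : PreAbstractSimplicialComplex V :=
  Δ.restrict {v | ∃ hv : v ∈ Δ.vertexSet, κ ⟨v, hv⟩ ∈ T}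

end PreAbstractSimplicialComplex

namespace SimplicialChain

variable {V Γ : Type*} [LinearOrder V] [AddCommGroup Γ]

/-- The simplicial boundary of a chain `c = ∑ a_F F`. For `F = {x_1 < ⋯ < x_m}`, the coefficient
of `F \ {x_j}` in `∂F` is `(-1)^j`; here `j` is the number of elements of `F` that are at
most `x_j`. -/
noncomputable def boundary (c : Finset V →₀ Γ) : Finset V →₀ Γ :=
  c.sum fun F a => ∑ x ∈ F,
    Finsupp.single (F.erase x) (((-1 : ℤ) ^ (F.filter (fun y => y ≤ x)).card) • a)

/-- `c` is a `(d-1)`-cycle: a combination of `d`-element sets with zero boundary. -/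
def IsCycle (d : ℕ) (c : Finset V →₀ Γ) : Prop :=
  (∀ F ∈ c.support, F.card = d) ∧ boundary c = 0

/-- `b` is a subchain of `c`. -/
def IsSubchain (b c : Finset V →₀ Γ) : Prop :=
  ∀ F, b F = c F ∨ b F = 0

/-- `c` is a minimal `(d-1)`-cycle: its only subchains that are `(d-1)`-cycles are `c` and `0`. -/
def IsMinimalCycle (d : ℕ) (c : Finset V →₀ Γ) : Prop :=
  IsCycle d c ∧ ∀ b : Finset V →₀ Γ, IsSubchain b c → IsCycle d b → b = c ∨ b = 0

end SimplicialChain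

/-- `Δ` is a minimal `(d-1)`-cycle complex over `Γ`: it is spanned by a single `d`-element set
(the trivial case), or by the support of a nonzero minimal `(d-1)`-cycle with coefficients
in `Γ`. -/
def PreAbstractSimplicialComplex.IsMinimalCycleComplex {V : Type*} [LinearOrder V]
    (Δ : PreAbstractSimplicialComplex V) (Γ : Type*) [AddCommGroup Γ] (d : ℕ) : Prop :=
  (∃ F : Finset V, F.card = d ∧ Δ = spannedBy {F}) ∨
  (∃ c : Finset V →₀ Γ, c ≠ 0 ∧ SimplicialChain.IsMinimalCycle d c ∧
    Δ = spannedBy (c.support : Set (Finset V)))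

/-!
The second claim implies the first, since each facet of a balanced complex has one vertex of each
colour, so that `κ⁻¹(T)` meets it in exactly `|T|` vertices. The second is proved by Fogelsanger's
induction on the vertices of a minimal cycle `c`, carrying the transversal set `U` along.

A facet has at least three vertices in `U`, hence an edge `u v` inside `U`. The contraction of `v`
to `u` is a chain map, so it takes `c` to a cycle, which splits into minimal cycles `b`. Let `y` be
the part of `c` that contracts onto `b`. As both ends of the edge lie in `U`, the faces of `b` still
have at least `k` vertices in `U`, so the graph of `b` on `U` is rigid by induction. The chain `y`
omits the facets containing `u v`, so it is a proper subchain of `c` and is not a cycle; the faces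
of its boundary provide `k - 1` common neighbours of `u` and `v` in `U`
(`SimplicialChain.exists_common_neighbours`). By vertex splitting
(`eventually_isRigidOn_of_vertex_split`) the graph of `y` together with `u v` is rigid. Facets of
`c` whose images cancel come in pairs, which with `u v` span a complete graph.

The pieces are glued through minimality. Let `q` be a motion at a generic position that vanishes on
one facet (within `U`), and let `Z` be the family of faces on which it vanishes. Each piece lies in
`Z` or misses it, and this makes the part of `c` in `Z` a cycle
(`SimplicialChain.bd_indicator_eq_zero_of_pieces`); being a nonzero subchain it is all of `c`, so
`q = 0`.

Genericity is expressed by a filter, generated by the nonvanishing sets of nonzero polynomials;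
rigidity of a framework with a pinned clique is the nonvanishing of a Gram determinant
(`isPinned_iff`), which gives both genericity and stability under perturbation.
-/

/-! ### Generic configurations -/

section GenericRigidity

variable {V : Type*} {k : ℕ}

/-- The filter of generic properties of configurations `p : V → ℝ^k`: those that hold wherever some
nonzero polynomial in the coordinates does not vanish. -/
def genericFilter (V : Type*) (k : ℕ) : Filter (V → Fin k → ℝ) where
  sets := {s | ∃ f : MvPolynomial (V × Fin k) ℝ, f ≠ 0 ∧
    ∀ p : V → Fin k → ℝ, MvPolynomial.eval (Function.uncurry p) f ≠ 0 → p ∈ s}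
  univ_sets := ⟨1, one_ne_zero, fun _ _ => trivial⟩
  sets_of_superset := by
    rintro s t ⟨f, hf, h⟩ hst
    exact ⟨f, hf, fun p hp => hst (h p hp)⟩
  inter_sets := by
    rintro s t ⟨f, hf, h⟩ ⟨g, hg, h'⟩
    refine ⟨f * g, mul_ne_zero hf hg, fun p hp => ?_⟩
    rw [map_mul] at hp
    exact ⟨h p (left_ne_zero_of_mul hp), h' p (right_ne_zero_of_mul hp)⟩

instance genericFilter_neBot : (genericFilter V k).NeBot := by
  refine ⟨fun h => ?_⟩
  have h0 : (∅ : Set (V → Fin k → ℝ)) ∈ genericFilter V k := Filter.empty_mem_iff_bot.mpr h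
  obtain ⟨f, hf, hp⟩ := h0
  refine hf (MvPolynomial.funext fun x => ?_)
  rw [map_zero]
  by_contra hx
  exact hp (Function.curry x) (by rwa [Function.uncurry_curry])

theorem eventually_generic_of_eval_ne_zero (f : MvPolynomial (V × Fin k) ℝ) (p₀ : V → Fin k → ℝ)
    (h : MvPolynomial.eval (Function.uncurry p₀) f ≠ 0) :
    ∀ᶠ p in genericFilter V k, MvPolynomial.eval (Function.uncurry p) f ≠ 0 :=
  ⟨f, by rintro rfl; simp at h, fun _ hp => hp⟩

theorem eventually_generic_det_ne_zero {n : Type*} [Fintype n] [DecidableEq n]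
    (M : Matrix n n (MvPolynomial (V × Fin k) ℝ)) (p₀ : V → Fin k → ℝ)
    (h : (M.map (MvPolynomial.eval (Function.uncurry p₀))).det ≠ 0) :
    ∀ᶠ p in genericFilter V k, (M.map (MvPolynomial.eval (Function.uncurry p))).det ≠ 0 := by
  have key : ∀ p : V → Fin k → ℝ, MvPolynomial.eval (Function.uncurry p) M.det =
      (M.map (MvPolynomial.eval (Function.uncurry p))).det := fun p => by
    rw [RingHom.map_det, RingHom.mapMatrix_apply]
  rw [← key] at h
  filter_upwards [eventually_generic_of_eval_ne_zero _ _ h] with p hp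
  rwa [← key]

/-- Generic points, together with the origin, are affinely independent. -/
theorem eventually_generic_det_points [DecidableEq V] {L : Fin k → V} (hL : L.Injective) :
    ∀ᶠ p in genericFilter V k, (Matrix.of fun i => p (L i)).det ≠ 0 := by
  have := eventually_generic_det_ne_zero (V := V) (k := k)
    (Matrix.of fun i j => MvPolynomial.X (L i, j))
    (fun x j => if x = L j then 1 else 0) (by
      have : ((Matrix.of fun i j => (MvPolynomial.X (L i, j) : MvPolynomial (V × Fin k) ℝ)).map
          (MvPolynomial.eval (Function.uncurry fun x j => if x = L j then (1 : ℝ) else 0))) = 1 := by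
        ext i j
        simp [Matrix.one_apply, hL.eq_iff]
      rw [this, Matrix.det_one]
      exact one_ne_zero)
  filter_upwards [this] with p hp
  convert hp using 2
  ext i j
  simp

/-- Any `k + 1` generic points of `ℝ^k` are affinely independent. -/
theorem eventually_generic_det_sub [DecidableEq V] {L : Fin k → V} (hL : L.Injective) {x : V}
    (hx : ∀ i, L i ≠ x) :
    ∀ᶠ p in genericFilter V k, (Matrix.of fun i => p x - p (L i)).det ≠ 0 := by
  have := eventually_generic_det_ne_zero (V := V) (k := k)
    (Matrix.of fun i j => MvPolynomial.X (x, j) - MvPolynomial.X (L i, j))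
    (fun x j => if x = L j then -1 else 0) (by
      have : ((Matrix.of fun i j => (MvPolynomial.X (x, j) - MvPolynomial.X (L i, j) :
          MvPolynomial (V × Fin k) ℝ)).map
          (MvPolynomial.eval (Function.uncurry fun x j => if x = L j then (-1 : ℝ) else 0))) = 1 := by
        ext i j
        simp only [Matrix.map_apply, Matrix.of_apply, map_sub, MvPolynomial.eval_X,
          Function.uncurry_apply_pair, hL.eq_iff, Matrix.one_apply]
        rw [if_neg (hx j).symm]
        split_ifs <;> simp
      rw [this, Matrix.det_one]
      exact one_ne_zero)
  filter_upwards [this] with p hp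
  convert hp using 2
  ext i j
  simp

/-! ### Infinitesimal motions -/

/-- `q` preserves to first order, at `p`, the lengths of the edges of `E` within `W`. -/
def IsMotionOn (E : V → V → Prop) (W : Finset V) (p q : V → Fin k → ℝ) : Prop :=
  ∀ x ∈ W, ∀ y ∈ W, E x y → (p x - p y) ⬝ᵥ (q x - q y) = 0

/-- The framework at `p` with vertex set `W` and the edges of `E` within `W` is infinitesimally
rigid. -/
def IsRigidOn (E : V → V → Prop) (W : Finset V) (p : V → Fin k → ℝ) : Prop :=
  ∀ q : V → Fin k → ℝ, IsMotionOn E W p q →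
    ∃ (S : Matrix (Fin k) (Fin k) ℝ) (t : Fin k → ℝ), Sᵀ = -S ∧ ∀ x ∈ W, q x = S *ᵥ p x + t

theorem dotProduct_mulVec_self_of_skew {S : Matrix (Fin k) (Fin k) ℝ} (hS : Sᵀ = -S)
    (x : Fin k → ℝ) : x ⬝ᵥ S *ᵥ x = 0 := by
  have h : x ⬝ᵥ S *ᵥ x = -(x ⬝ᵥ S *ᵥ x) := by
    conv_lhs => rw [Matrix.dotProduct_mulVec, ← Matrix.mulVec_transpose, hS, Matrix.neg_mulVec,
      neg_dotProduct, dotProduct_comm]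
  linarith

theorem IsMotionOn.sub_trivial {E : V → V → Prop} {W : Finset V} {p q : V → Fin k → ℝ}
    (hq : IsMotionOn E W p q) {S : Matrix (Fin k) (Fin k) ℝ} (hS : Sᵀ = -S) (t : Fin k → ℝ) :
    IsMotionOn E W p (fun x => q x - (S *ᵥ p x + t)) := by
  intro x hx y hy hxy
  have e : q x - (S *ᵥ p x + t) - (q y - (S *ᵥ p y + t)) =
      (q x - q y) - S *ᵥ (p x - p y) := by
    rw [Matrix.mulVec_sub]; abel
  simp only [e]
  rw [dotProduct_sub, hq x hx y hy hxy, dotProduct_mulVec_self_of_skew hS, sub_zero]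

theorem eq_zero_of_det_ne_zero {v : Fin k → Fin k → ℝ} (hv : (Matrix.of v).det ≠ 0)
    {z : Fin k → ℝ} (h : ∀ i, v i ⬝ᵥ z = 0) : z = 0 := by
  refine Matrix.eq_zero_of_mulVec_eq_zero hv ?_
  ext i
  exact h i

/-- A trivial motion that vanishes on `k` points which are affinely independent together with the
origin vanishes identically. -/
theorem trivial_motion_eq_zero {v : Fin k → Fin k → ℝ} (hv : (Matrix.of v).det ≠ 0)
    {S : Matrix (Fin k) (Fin k) ℝ} (hS : Sᵀ = -S) {t : Fin k → ℝ}
    (h : ∀ i, S *ᵥ v i + t = 0) (x : Fin k → ℝ) : S *ᵥ x + t = 0 := by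
  have ht : t = 0 := eq_zero_of_det_ne_zero hv fun i => by
    have := congrArg (fun z => v i ⬝ᵥ z) (h i)
    simpa [dotProduct_add, dotProduct_mulVec_self_of_skew hS] using this
  subst ht
  have hSx : S *ᵥ x = 0 := eq_zero_of_det_ne_zero hv fun i => by
    have h1 : S *ᵥ v i = 0 := by simpa using h i
    rw [Matrix.dotProduct_mulVec, ← Matrix.mulVec_transpose, hS, Matrix.neg_mulVec, h1]
    simp
  simp [hSx]

/-- Every motion of the complete framework on `k` points, affinely independent together with the
origin, is trivial: prescribing that no distance to the origin changes determines the velocity `t`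
of the origin, and hence the skew-symmetric matrix. -/
theorem exists_trivial_motion {v w : Fin k → Fin k → ℝ} (hv : (Matrix.of v).det ≠ 0)
    (h : ∀ i j, (v i - v j) ⬝ᵥ (w i - w j) = 0) :
    ∃ (S : Matrix (Fin k) (Fin k) ℝ) (t : Fin k → ℝ), Sᵀ = -S ∧ ∀ i, w i = S *ᵥ v i + t := by
  set A : Matrix (Fin k) (Fin k) ℝ := Matrix.of v with hA
  have hu : IsUnit A.det := isUnit_iff_ne_zero.mpr hv
  set t : Fin k → ℝ := A⁻¹ *ᵥ (fun i => v i ⬝ᵥ w i) with ht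
  have ht' : ∀ i, v i ⬝ᵥ t = v i ⬝ᵥ w i := by
    intro i
    have : A *ᵥ t = fun i => v i ⬝ᵥ w i := by
      rw [ht, Matrix.mulVec_mulVec, Matrix.mul_nonsing_inv _ hu, Matrix.one_mulVec]
    exact congrFun this i
  set B : Matrix (Fin k) (Fin k) ℝ := Matrix.of fun i => w i - t with hB
  have hskew : B * Aᵀ = -(A * Bᵀ) := by
    ext i j
    have h1 : (B * Aᵀ) i j = (w i - t) ⬝ᵥ v j := rfl
    have h2 : (A * Bᵀ) i j = v i ⬝ᵥ (w j - t) := rfl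
    rw [Matrix.neg_apply, h1, h2]
    have h3 := h i j
    simp only [sub_dotProduct, dotProduct_sub] at h3 ⊢
    have e1 := ht' i
    have e2 := ht' j
    rw [dotProduct_comm t (v j), dotProduct_comm (w i) (v j)]
    linarith
  have huT : IsUnit Aᵀ.det := by rwa [Matrix.det_transpose]
  refine ⟨(A⁻¹ * B)ᵀ, t, ?_, fun i => ?_⟩
  · have e : A⁻¹ * B = -(A⁻¹ * B)ᵀ := by
      have : A⁻¹ * (B * Aᵀ) * Aᵀ⁻¹ = A⁻¹ * (-(A * Bᵀ)) * Aᵀ⁻¹ := by rw [hskew]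
      rw [← Matrix.mul_assoc, Matrix.mul_nonsing_inv_cancel_right _ _ huT, Matrix.mul_neg,
        Matrix.nonsing_inv_mul_cancel_left _ _ hu] at this
      rw [Matrix.transpose_mul, Matrix.transpose_nonsing_inv, ← Matrix.neg_mul]
      exact this
    rw [Matrix.transpose_transpose]
    exact e
  · have h5 : (A⁻¹ * B)ᵀ *ᵥ v i = B i := by
      have h6 : A * (A⁻¹ * B) = B := Matrix.mul_nonsing_inv_cancel_left _ _ hu
      rw [Matrix.mulVec_transpose]
      conv_rhs => rw [← h6]
      rfl
    have h7 : B i = w i - t := rfl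
    rw [h5, h7, sub_add_cancel]

/-! ### The matrix of a pinned framework -/

open Classical in
/-- The matrix of the linear system `D x y ⬝ᵥ (q x - q y) = 0` for the edges `x y` of `E` within
`W`, together with `q x = 0` for `x ∈ A`. -/
noncomputable def pinnedMatrix {R : Type*} [CommRing R] (E : V → V → Prop) (A W : Finset V)
    (D : V → V → Fin k → R) : Matrix ((W × W) ⊕ (W × Fin k)) (W × Fin k) R :=
  Matrix.of fun r z => Sum.elim
    (fun e : W × W => if E e.1 e.2 then
      D e.1 e.2 z.2 * ((if z.1 = e.1 then 1 else 0) - (if z.1 = e.2 then 1 else 0)) else 0)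
    (fun a => if (a.1 : V) ∈ A ∧ z = a then 1 else 0) r

/-- The linear system of `pinnedMatrix` has only the zero solution on `W`. With
`D x y = p x - p y` this says that the framework at `p` admits no nonzero motion that fixes `A`. -/
def IsPinned (E : V → V → Prop) (A W : Finset V) (D : V → V → Fin k → ℝ) : Prop :=
  ∀ q : V → Fin k → ℝ, (∀ x ∈ W, ∀ y ∈ W, E x y → D x y ⬝ᵥ (q x - q y) = 0) →
    (∀ x ∈ A, q x = 0) → ∀ x ∈ W, q x = 0

theorem pinnedMatrix_map {R R' : Type*} [CommRing R] [CommRing R'] (φ : R →+* R')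
    (E : V → V → Prop) (A W : Finset V) (D : V → V → Fin k → R) :
    (pinnedMatrix E A W D).map φ = pinnedMatrix E A W (fun x y i => φ (D x y i)) := by
  classical
  ext r z
  rcases r with e | a
  · simp only [pinnedMatrix, Matrix.map_apply, Matrix.of_apply, Sum.elim_inl]
    split_ifs <;> simp
  · simp only [pinnedMatrix, Matrix.map_apply, Matrix.of_apply, Sum.elim_inr]
    split_ifs <;> simp

theorem pinnedMatrix_mulVec_inl (E : V → V → Prop) (A W : Finset V) (D : V → V → Fin k → ℝ)
    (w : W × Fin k → ℝ) (x y : W) (h : E x y) :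
    (pinnedMatrix E A W D *ᵥ w) (Sum.inl (x, y)) =
      D x y ⬝ᵥ ((fun i => w (x, i)) - fun i => w (y, i)) := by
  classical
  simp only [Matrix.mulVec, dotProduct, pinnedMatrix, Matrix.of_apply, Sum.elim_inl, h, if_true,
    Fintype.sum_prod_type, Pi.sub_apply]
  rw [Finset.sum_comm]
  refine Finset.sum_congr rfl fun i _ => ?_
  have : ∀ z : W, D x y i * ((if z = x then 1 else 0) - (if z = y then 1 else 0)) * w (z, i) =
    (if z = x then D x y i * w (z, i) else 0) - (if z = y then D x y i * w (z, i) else 0) := by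
    intro z; split_ifs <;> ring
  simp only [this, Finset.sum_sub_distrib, Finset.sum_ite_eq', Finset.mem_univ, if_true]
  ring

theorem pinnedMatrix_mulVec_inr (E : V → V → Prop) (A W : Finset V) (D : V → V → Fin k → ℝ)
    (w : W × Fin k → ℝ) (a : W × Fin k) (h : (a.1 : V) ∈ A) :
    (pinnedMatrix E A W D *ᵥ w) (Sum.inr a) = w a := by
  classical
  simp [Matrix.mulVec, dotProduct, pinnedMatrix, h]

theorem isPinned_iff [DecidableEq V] (E : V → V → Prop) (A W : Finset V) (D : V → V → Fin k → ℝ) :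
    IsPinned E A W D ↔ ((pinnedMatrix E A W D)ᵀ * pinnedMatrix E A W D).det ≠ 0 := by
  classical
  set M := pinnedMatrix E A W D with hM
  have h1 : (Mᵀ * M).det ≠ 0 ↔ ∀ w, M *ᵥ w = 0 → w = 0 := by
    rw [Ne, ← Matrix.exists_mulVec_eq_zero_iff, not_exists]
    refine forall_congr' fun w => ?_
    have := Matrix.conjTranspose_mul_self_mulVec_eq_zero M w
    rw [Matrix.conjTranspose_eq_transpose_of_trivial] at this
    rw [this]
    tauto
  rw [h1]
  constructor
  · intro h w hw
    have := h (fun x i => if hx : x ∈ W then w (⟨x, hx⟩, i) else 0) (fun x hx y hy hxy => by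
        have h2 := congrFun hw (Sum.inl (⟨x, hx⟩, ⟨y, hy⟩))
        rw [pinnedMatrix_mulVec_inl E A W D w _ _ hxy] at h2
        simpa [hx, hy] using h2) (fun x hx => by
        ext i
        by_cases hxW : x ∈ W
        · have h2 := congrFun hw (Sum.inr (⟨x, hxW⟩, i))
          rw [pinnedMatrix_mulVec_inr E A W D w (⟨x, hxW⟩, i) hx] at h2
          simpa [hxW] using h2
        · simp [hxW])
    ext ⟨⟨x, hx⟩, i⟩
    simpa [hx] using congrFun (this x hx) i
  · intro h q hq hA x hx
    have := h (fun a => q a.1 a.2) (by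
      ext r
      rcases r with ⟨x, y⟩ | a
      · by_cases hxy : E x y
        · rw [pinnedMatrix_mulVec_inl E A W D _ _ _ hxy]
          exact hq x x.2 y y.2 hxy
        · simp [Matrix.mulVec, dotProduct, pinnedMatrix, hM, hxy]
      · by_cases ha : (a.1 : V) ∈ A
        · rw [pinnedMatrix_mulVec_inr E A W D _ _ ha]
          exact congrFun (hA _ ha) _
        · simp [Matrix.mulVec, dotProduct, pinnedMatrix, hM, ha])
    ext i
    exact congrFun this (⟨x, hx⟩, i)

theorem IsPinned.eventually_generic {E : V → V → Prop} {A W : Finset V} {p₀ : V → Fin k → ℝ}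
    (h : IsPinned E A W fun x y => p₀ x - p₀ y) :
    ∀ᶠ p in genericFilter V k, IsPinned E A W fun x y => p x - p y := by
  classical
  set D : V → V → Fin k → MvPolynomial (V × Fin k) ℝ :=
    fun x y i => MvPolynomial.X (x, i) - MvPolynomial.X (y, i) with hD
  have key : ∀ p : V → Fin k → ℝ,
      ((pinnedMatrix E A W D)ᵀ * pinnedMatrix E A W D).map
        (MvPolynomial.eval (Function.uncurry p)) =
      (pinnedMatrix E A W fun x y => p x - p y)ᵀ * pinnedMatrix E A W fun x y => p x - p y := by
    intro p
    rw [Matrix.map_mul, Matrix.transpose_map, pinnedMatrix_map]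
    have : (fun x y i => MvPolynomial.eval (Function.uncurry p) (D x y i)) =
        fun x y => p x - p y := by
      ext x y i
      simp [hD]
    rw [this]
  rw [isPinned_iff, ← key] at h
  filter_upwards [eventually_generic_det_ne_zero _ _ h] with p hp
  rwa [isPinned_iff, ← key]

theorem IsPinned.exists_ne_zero {E : V → V → Prop} {A W : Finset V} {D : ℝ → V → V → Fin k → ℝ}
    (hD : ∀ x y i, Continuous fun ε => D ε x y i) (h : IsPinned E A W (D 0)) :
    ∃ ε : ℝ, ε ≠ 0 ∧ IsPinned E A W (D ε) := by
  classical
  have hc : Continuous fun ε => pinnedMatrix E A W (D ε) := by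
    refine continuous_matrix fun r z => ?_
    rcases r with e | a
    · simp only [pinnedMatrix, Matrix.of_apply, Sum.elim_inl]
      split_ifs <;> first | exact continuous_const | exact (hD _ _ _).mul continuous_const
    · simp only [pinnedMatrix, Matrix.of_apply, Sum.elim_inr]
      exact continuous_const
  have hdet := (hc.matrix_transpose.matrix_mul hc).matrix_det
  rw [isPinned_iff] at h
  have h1 := ((hdet.continuousAt (x := 0)).eventually_ne h).filter_mono
    (nhdsWithin_le_nhds (s := {0}ᶜ))
  obtain ⟨ε, h2, h3⟩ := (h1.and self_mem_nhdsWithin).exists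
  exact ⟨ε, h3, (isPinned_iff _ _ _ _).mpr h2⟩

end GenericRigidity

/-! ### General position and vertex splitting -/

section VertexSplitting

variable {V : Type*} {k : ℕ}

/-- The points of `N` and the origin are in general position at `p`: no `k + 1` of them lie on a
common hyperplane of `ℝ^k`. -/
def InGeneralPosition (N : Finset V) (p : V → Fin k → ℝ) : Prop :=
  (∀ L : Fin k ↪ N, (Matrix.of fun i => p (L i)).det ≠ 0) ∧
    ∀ (L : Fin k ↪ N) (x : N), (∀ i, L i ≠ x) → (Matrix.of fun i => p x - p (L i)).det ≠ 0

theorem eventually_inGeneralPosition [DecidableEq V] (N : Finset V) :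
    ∀ᶠ p in genericFilter V k, InGeneralPosition N p := by
  have hinj : ∀ L : Fin k ↪ N, Function.Injective fun i => (L i : V) :=
    fun L => Subtype.val_injective.comp L.injective
  refine Filter.Eventually.and ?_ ?_
  · rw [Filter.eventually_all]
    exact fun L => eventually_generic_det_points (hinj L)
  · rw [Filter.eventually_all]
    intro L
    rw [Filter.eventually_all]
    intro x
    by_cases hx : ∀ i, L i ≠ x
    · filter_upwards [eventually_generic_det_sub (hinj L) (x := x)
        fun i h => hx i (Subtype.ext h)] with p hp _ using hp
    · exact Filter.Eventually.of_forall fun p h => absurd h hx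

theorem exists_embedding_of_le_card {A N : Finset V} (hAN : A ⊆ N) (hA : k ≤ A.card) :
    ∃ L : Fin k ↪ N, ∀ i, (L i : V) ∈ A := by
  obtain ⟨f⟩ : Nonempty (Fin k ↪ A) := by
    refine Function.Embedding.nonempty_of_card_le ?_
    simpa using hA
  exact ⟨f.trans ⟨fun a => ⟨a, hAN a.2⟩, fun a b h => Subtype.ext (by simpa using h)⟩,
    fun i => (f i).2⟩

theorem exists_embedding_of_card_eq {A N : Finset V} (hAN : A ⊆ N) (hA : A.card = k) :
    ∃ L : Fin k ↪ N, (∀ i, (L i : V) ∈ A) ∧ ∀ x ∈ A, ∃ i, (L i : V) = x := by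
  have e : Fin k ≃ A := (finCongr hA.symm).trans A.equivFin.symm
  exact ⟨e.toEmbedding.trans ⟨fun a => ⟨a, hAN a.2⟩, fun a b h => Subtype.ext (by simpa using h)⟩,
    fun i => (e i).2, fun x hx => ⟨e.symm ⟨x, hx⟩, congrArg Subtype.val (e.apply_symm_apply _)⟩⟩

namespace InGeneralPosition

variable {N A : Finset V} {p : V → Fin k → ℝ}

theorem trivial_motion_eq_zero (hp : InGeneralPosition N p) (hAN : A ⊆ N) (hA : k ≤ A.card)
    {S : Matrix (Fin k) (Fin k) ℝ} (hS : Sᵀ = -S) {t : Fin k → ℝ}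
    (h : ∀ x ∈ A, S *ᵥ p x + t = 0) (z : Fin k → ℝ) : S *ᵥ z + t = 0 := by
  obtain ⟨L, hL⟩ := exists_embedding_of_le_card hAN hA
  exact _root_.trivial_motion_eq_zero (hp.1 L) hS (fun i => h _ (hL i)) z

theorem exists_trivial_motion (hp : InGeneralPosition N p) (hAN : A ⊆ N) (hA : A.card = k)
    {q : V → Fin k → ℝ} (hq : ∀ x ∈ A, ∀ y ∈ A, (p x - p y) ⬝ᵥ (q x - q y) = 0) :
    ∃ (S : Matrix (Fin k) (Fin k) ℝ) (t : Fin k → ℝ), Sᵀ = -S ∧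
      ∀ x ∈ A, q x = S *ᵥ p x + t := by
  obtain ⟨L, hL, hL'⟩ := exists_embedding_of_card_eq hAN hA
  obtain ⟨S, t, hS, h⟩ := _root_.exists_trivial_motion (hp.1 L) (w := fun i => q (L i))
    fun i j => hq _ (hL i) _ (hL j)
  refine ⟨S, t, hS, fun x hx => ?_⟩
  obtain ⟨i, rfl⟩ := hL' x hx
  exact h i

/-- A vertex joined to `k` immobile points in general position is immobile. -/
theorem eq_zero_of_joined (hp : InGeneralPosition N p) (hAN : A ⊆ N) (hA : k ≤ A.card) {x : V}
    (hx : x ∈ N) {q : V → Fin k → ℝ} (hqA : ∀ y ∈ A, q y = 0)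
    (hq : ∀ y ∈ A, (p x - p y) ⬝ᵥ (q x - q y) = 0) : q x = 0 := by
  by_cases hxA : x ∈ A
  · exact hqA x hxA
  obtain ⟨L, hL⟩ := exists_embedding_of_le_card hAN hA
  refine eq_zero_of_det_ne_zero (hp.2 L ⟨x, hx⟩ fun i h => hxA ?_) fun i => ?_
  · have := hL i
    rwa [h] at this
  · simpa [hqA _ (hL i)] using hq _ (hL i)

end InGeneralPosition

/-- A motion of a rigid framework that vanishes on `k` vertices vanishes. -/
theorem IsRigidOn.eq_zero {E : V → V → Prop} {W A N : Finset V} {p q : V → Fin k → ℝ}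
    (h : IsRigidOn E W p) (hp : InGeneralPosition N p) (hAN : A ⊆ N) (hAW : A ⊆ W)
    (hA : k ≤ A.card) (hq : IsMotionOn E W p q) (hqA : ∀ x ∈ A, q x = 0) : ∀ x ∈ W, q x = 0 := by
  obtain ⟨S, t, hS, hSt⟩ := h q hq
  intro x hx
  rw [hSt x hx]
  exact hp.trivial_motion_eq_zero hAN hA hS (fun y hy => by rw [← hSt y (hAW hy), hqA y hy]) _

theorem isRigidOn_of_isPinned {E : V → V → Prop} {W A : Finset V} {p : V → Fin k → ℝ}
    (hp : InGeneralPosition W p) (hAW : A ⊆ W) (hA : A.card = k)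
    (hE : ∀ x ∈ A, ∀ y ∈ A, x ≠ y → E x y) (h : IsPinned E A W fun x y => p x - p y) :
    IsRigidOn E W p := by
  intro q hq
  obtain ⟨S, t, hS, hSt⟩ := hp.exists_trivial_motion hAW hA (q := q) fun x hx y hy => by
    rcases eq_or_ne x y with rfl | hxy
    · simp
    · exact hq x (hAW hx) y (hAW hy) (hE x hx y hy hxy)
  refine ⟨S, t, hS, fun x hx => ?_⟩
  have := h _ (hq.sub_trivial hS t) (fun y hy => by rw [hSt y hy, sub_self]) x hx
  exact sub_eq_zero.mp this

/-- Whiteley's vertex splitting. The graph `E` on `insert v W` contracts along the edge `u v` to a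
supergraph of `E'`, and `u`, `v` have `k - 1` common neighbours; if `E'` is generically rigid, so is
`E`. The proof perturbs a framework in which `v` coincides with `u` but the edge `u v` keeps a
direction: there the common neighbours and the edge force `q u = q v`. The clique `A` serves to pin
the framework; it must not contain both `u` and `v`, so that its image under the contraction has
`k` vertices too. -/
theorem eventually_isRigidOn_of_vertex_split [DecidableEq V] {E E' : V → V → Prop}
    {W C A : Finset V} {u v : V} (hE' : ∀ᶠ p in genericFilter V k, IsRigidOn E' W p)
    (hu : u ∈ W) (hv : v ∉ W) (hsymm' : ∀ x y, E' x y → E' y x)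
    (hold : ∀ x y, E' x y → x ≠ y → x ≠ u → y ≠ u → E x y)
    (hnew : ∀ x, E' u x → x ≠ u → E u x ∨ E v x) (huv : E u v)
    (hCW : C ⊆ W) (huC : u ∉ C) (hCcard : C.card + 1 = k) (hCu : ∀ x ∈ C, E u x)
    (hCv : ∀ x ∈ C, E v x) (hAW : A ⊆ insert v W) (hA : A.card = k) (hAuv : u ∉ A ∨ v ∉ A)
    (hAE : ∀ x ∈ A, ∀ y ∈ A, x ≠ y → E x y) :
    ∀ᶠ p in genericFilter V k, IsRigidOn E (insert v W) p := by
  have huv_ne : u ≠ v := fun h => hv (h ▸ hu)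
  obtain ⟨p, hp, hgp⟩ := (hE'.and (eventually_inGeneralPosition (insert v W))).exists
  -- the position `p ε` approaches one with `v` at the place of `u`, along the line through `p v`
  let pos : ℝ → V → Fin k → ℝ := fun ε => Function.update p v (p u + ε • (p v - p u))
  let D : ℝ → V → V → Fin k → ℝ := fun ε x y =>
    if (x = u ∧ y = v) ∨ (x = v ∧ y = u) then p v - p u else pos ε x - pos ε y
  have hpos : ∀ ε, ∀ x, x ≠ v → pos ε x = p x := fun ε x hx => Function.update_of_ne hx _ _
  have hposv : ∀ ε, pos ε v = p u + ε • (p v - p u) := fun ε => Function.update_self _ _ _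
  have hDcont : ∀ x y i, Continuous fun ε => D ε x y i := by
    have h1 : ∀ x i, Continuous fun ε => pos ε x i := by
      intro x i
      rcases eq_or_ne x v with rfl | hx
      · simp only [hposv, Pi.add_apply, Pi.smul_apply, smul_eq_mul]
        fun_prop
      · simp only [hpos _ _ hx]
        exact continuous_const
    intro x y i
    simp only [D]
    split_ifs
    · exact continuous_const
    · exact (h1 x i).sub (h1 y i)
  have hpin : IsPinned E A (insert v W) (D 0) := by
    intro q hq hqA
    have hq0 : ∀ x ∈ insert v W, ∀ y ∈ insert v W, E x y → ¬((x = u ∧ y = v) ∨ (x = v ∧ y = u)) →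
        (pos 0 x - pos 0 y) ⬝ᵥ (q x - q y) = 0 := by
      intro x hx y hy hxy hne
      have := hq x hx y hy hxy
      simpa only [D, if_neg hne] using this
    have hv0 : pos 0 v = p u := by simp [hposv]
    have hquv : q u - q v = 0 := by
      have hins : (insert v C) ⊆ insert v W := Finset.insert_subset_insert _ hCW
      have hvC : v ∉ C := fun h => hv (hCW h)
      refine hgp.eq_zero_of_joined (A := insert v C) (x := u) hins ?_
        (Finset.mem_insert_of_mem hu) (q := fun z => if z = u then q u - q v else 0) ?_ ?_
        |>.symm.trans (by simp) |>.symm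
      · rw [Finset.card_insert_of_notMem hvC, hCcard]
      · intro y hy
        have : y ≠ u := by
          rintro rfl
          rcases Finset.mem_insert.mp hy with h | h
          · exact huv_ne h
          · exact huC h
        simp [this]
      · intro y hy
        rcases Finset.mem_insert.mp hy with rfl | hy
        · have h1 := hq u (Finset.mem_insert_of_mem hu) y (Finset.mem_insert_self _ _) huv
          have h2 : D 0 u y = p y - p u := by simp [D]
          rw [h2] at h1
          simp only [if_true, if_neg huv_ne.symm, sub_zero]
          rw [← neg_sub, neg_dotProduct, h1, neg_zero]
        · have hyW := hCW hy
          have hyv : y ≠ v := fun h => hv (h ▸ hyW)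
          have hyu : y ≠ u := fun h => huC (h ▸ hy)
          have h1 := hq0 u (Finset.mem_insert_of_mem hu) y (Finset.mem_insert_of_mem hyW)
            (hCu y hy) (by tauto)
          have h2 := hq0 v (Finset.mem_insert_self _ _) y (Finset.mem_insert_of_mem hyW)
            (hCv y hy) (by tauto)
          rw [hv0, hpos _ _ hyv] at h2
          rw [hpos _ _ huv_ne, hpos _ _ hyv] at h1
          simp only [if_true, if_neg hyu, sub_zero]
          rw [dotProduct_sub] at h1 h2 ⊢
          linarith
    have hquv' : q u = q v := sub_eq_zero.mp hquv
    have hW : ∀ x ∈ W, x ≠ v := fun x hx h => hv (h ▸ hx)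
    have hmotion : IsMotionOn E' W p q := by
      have hux : ∀ x ∈ W, E' u x → (p u - p x) ⬝ᵥ (q u - q x) = 0 := by
        intro x hx hxE
        rcases eq_or_ne x u with rfl | hxu
        · simp
        have hxv := hW x hx
        rcases hnew x hxE hxu with h | h
        · have := hq0 u (Finset.mem_insert_of_mem hu) x (Finset.mem_insert_of_mem hx) h (by tauto)
          rwa [hpos _ _ huv_ne, hpos _ _ hxv] at this
        · have := hq0 v (Finset.mem_insert_self _ _) x (Finset.mem_insert_of_mem hx) h (by tauto)
          rwa [hv0, hpos _ _ hxv, ← hquv'] at this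
      intro x hx y hy hxy
      rcases eq_or_ne x u with rfl | hxu
      · exact hux y hy hxy
      rcases eq_or_ne y u with rfl | hyu
      · rw [← neg_sub, ← neg_sub (q y), neg_dotProduct_neg]
        exact hux x hx (hsymm' _ _ hxy)
      rcases eq_or_ne x y with rfl | hne
      · simp
      have := hq0 x (Finset.mem_insert_of_mem hx) y (Finset.mem_insert_of_mem hy)
        (hold x y hxy hne hxu hyu) (by tauto)
      rwa [hpos _ _ (hW x hx), hpos _ _ (hW y hy)] at this
    -- the image of the pinned clique under the contraction
    have hzero : ∀ x ∈ W, q x = 0 := by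
      by_cases hvA : v ∈ A
      · have huA : u ∉ A := hAuv.resolve_right (not_not.mpr hvA)
        have hsub : insert u (A.erase v) ⊆ W := by
          intro x hx
          rcases Finset.mem_insert.mp hx with rfl | hx
          · exact hu
          · obtain ⟨h1, h2⟩ := Finset.mem_erase.mp hx
            exact (Finset.mem_insert.mp (hAW h2)).resolve_left h1
        refine hp.eq_zero hgp (A := insert u (A.erase v)) (hsub.trans (Finset.subset_insert _ _))
          hsub ?_ hmotion ?_
        · rw [Finset.card_insert_of_notMem (fun h => huA (Finset.mem_of_mem_erase h)),
            Finset.card_erase_of_mem hvA]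
          omega
        · intro x hx
          rcases Finset.mem_insert.mp hx with rfl | hx
          · rw [hquv']; exact hqA _ hvA
          · exact hqA _ (Finset.mem_of_mem_erase hx)
      · have hsub : A ⊆ W := fun x hx =>
          (Finset.mem_insert.mp (hAW hx)).resolve_left fun h => hvA (h ▸ hx)
        exact hp.eq_zero hgp hAW hsub hA.ge hmotion hqA
    intro x hx
    rcases Finset.mem_insert.mp hx with rfl | hx
    · rw [← hquv']; exact hzero u hu
    · exact hzero x hx
  obtain ⟨ε, hε, hpinε⟩ := hpin.exists_ne_zero hDcont
  have hpinpos : IsPinned E A (insert v W) fun x y => pos ε x - pos ε y := by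
    intro q hq hqA
    refine hpinε q (fun x hx y hy hxy => ?_) hqA
    have h : (pos ε x - pos ε y) ⬝ᵥ (q x - q y) = 0 := hq x hx y hy hxy
    by_cases hc : (x = u ∧ y = v) ∨ (x = v ∧ y = u)
    · simp only [D, if_pos hc]
      rcases hc with ⟨rfl, rfl⟩ | ⟨rfl, rfl⟩
      · rw [hposv, hpos _ _ huv_ne] at h
        have : p x - (p x + ε • (p y - p x)) = (-ε) • (p y - p x) := by
          rw [sub_add_cancel_left, neg_smul]
        rw [this, smul_dotProduct, smul_eq_mul] at h
        exact (mul_eq_zero.mp h).resolve_left (neg_ne_zero.mpr hε)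
      · rw [hposv, hpos _ _ huv_ne] at h
        rw [add_sub_cancel_left, smul_dotProduct, smul_eq_mul] at h
        exact (mul_eq_zero.mp h).resolve_left hε
    · simpa only [D, if_neg hc] using h
  filter_upwards [hpinpos.eventually_generic, eventually_inGeneralPosition (insert v W)]
    with p' h1 h2
  exact isRigidOn_of_isPinned h2 hAW hA hAE h1

end VertexSplitting

/-! ### Chains, contraction of an edge, and gluing -/

namespace SimplicialChain

variable {V Γ : Type*} [LinearOrder V] [AddCommGroup Γ]

/-- `-1` if `y ≤ x` and `1` otherwise: the contribution of `y` to the incidence sign of `x`. -/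
def pairSign (y x : V) : ℤ := if y ≤ x then -1 else 1

/-- The sign `(-1)^#{y ∈ G | y ≤ x}`. For `x ∉ G` it is, up to a global sign, the incidence number
of `insert x G` and `G`. -/
def faceSign (G : Finset V) (x : V) : ℤ := ∏ y ∈ G, pairSign y x

theorem pairSign_mul_self (y x : V) : pairSign y x * pairSign y x = 1 := by
  unfold pairSign; split_ifs <;> norm_num

theorem pairSign_swap {x y : V} (h : x ≠ y) : pairSign y x = -pairSign x y := by
  unfold pairSign
  rcases lt_or_gt_of_ne h with h | h
  · simp [h.le, h.not_ge]
  · simp [h.le, h.not_ge]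

theorem faceSign_mul_self (G : Finset V) (x : V) : faceSign G x * faceSign G x = 1 := by
  simp [faceSign, ← Finset.prod_mul_distrib, pairSign_mul_self]

theorem faceSign_insert {G : Finset V} {y : V} (h : y ∉ G) (x : V) :
    faceSign (insert y G) x = pairSign y x * faceSign G x :=
  Finset.prod_insert h

theorem faceSign_smul_eq_zero {G : Finset V} {x : V} {a : Γ} (h : faceSign G x • a = 0) :
    a = 0 := by
  have := congrArg (fun b => faceSign G x • b) h
  simpa [smul_smul, faceSign_mul_self] using this

/-- The boundary of a chain supported on subsets of `N`, up to a global sign. Chains are treated as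
functions, with no condition on their support. -/
def bd (N : Finset V) (c : Finset V → Γ) (G : Finset V) : Γ :=
  ∑ x ∈ N \ G, faceSign G x • c (insert x G)

theorem bd_zero (N : Finset V) : bd N (0 : Finset V → Γ) = 0 := by
  ext G; simp [bd]

theorem bd_add (N : Finset V) (b c : Finset V → Γ) : bd N (b + c) = bd N b + bd N c := by
  ext G; simp [bd, Finset.sum_add_distrib]

theorem exists_of_bd_ne_zero {N : Finset V} {c : Finset V → Γ} {G : Finset V}
    (h : bd N c G ≠ 0) : ∃ x ∈ N, x ∉ G ∧ c (insert x G) ≠ 0 := by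
  obtain ⟨x, hx, h⟩ := Finset.exists_ne_zero_of_sum_ne_zero h
  obtain ⟨h1, h2⟩ := Finset.mem_sdiff.mp hx
  exact ⟨x, h1, h2, fun h0 => h (by rw [h0, smul_zero])⟩

theorem bd_bd (N : Finset V) (c : Finset V → Γ) : bd N (bd N c) = 0 := by
  ext G
  simp only [bd, Finset.smul_sum, Pi.zero_apply]
  rw [Finset.sum_sigma']
  refine Finset.sum_involution (fun a _ => ⟨a.2, a.1⟩) ?_ ?_ ?_ ?_
  · rintro ⟨x, y⟩ h
    simp only [Finset.mem_sigma, Finset.mem_sdiff, Finset.mem_insert, not_or] at h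
    obtain ⟨⟨hx, hxG⟩, hy, hyx, hyG⟩ := h
    simp only
    rw [faceSign_insert hxG, faceSign_insert hyG, Finset.insert_comm y x, smul_smul, smul_smul,
      ← add_smul, pairSign_swap hyx]
    convert zero_smul ℤ _ using 2
    ring
  · rintro ⟨x, y⟩ h _ heq
    simp only [Finset.mem_sigma, Finset.mem_sdiff, Finset.mem_insert, not_or] at h
    exact h.2.2.1 (congrArg Sigma.fst heq)
  · rintro ⟨x, y⟩ h
    simp only [Finset.mem_sigma, Finset.mem_sdiff, Finset.mem_insert, not_or] at h ⊢
    exact ⟨⟨h.2.1, h.2.2.2⟩, h.1.1, fun e => h.2.2.1 e.symm, h.1.2⟩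
  · intros; rfl

section Contraction

variable {N A : Finset V} {u v : V}

theorem bd_insert_left (huv : u ≠ v) (hv : v ∈ N) (hvA : v ∉ A) (c : Finset V → Γ) :
    bd N c (insert u A) = faceSign (insert u A) v • c (insert u (insert v A)) +
      ∑ x ∈ N \ insert u (insert v A), faceSign (insert u A) x • c (insert u (insert x A)) := by
  have h : N \ insert u A = insert v (N \ insert u (insert v A)) := by
    ext x
    simp only [Finset.mem_sdiff, Finset.mem_insert, not_or]
    constructor
    · rintro ⟨h1, h2, h3⟩
      by_cases hx : x = v <;> simp_all
    · rintro (rfl | ⟨h1, h2, h3, h4⟩)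
      · exact ⟨hv, huv.symm, hvA⟩
      · exact ⟨h1, h2, h4⟩
  rw [bd, h, Finset.sum_insert (by simp)]
  simp only [Finset.insert_comm u]

theorem bd_insert_right (huv : u ≠ v) (hu : u ∈ N) (huA : u ∉ A) (c : Finset V → Γ) :
    bd N c (insert v A) = faceSign (insert v A) u • c (insert u (insert v A)) +
      ∑ x ∈ N \ insert u (insert v A), faceSign (insert v A) x • c (insert v (insert x A)) := by
  rw [bd_insert_left huv.symm hu huA, Finset.insert_comm v u]

theorem bd_avoiding (huv : u ≠ v) (hu : u ∈ N) (hv : v ∈ N) (huA : u ∉ A) (hvA : v ∉ A)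
    (c : Finset V → Γ) :
    bd N c A = faceSign A u • c (insert u A) + faceSign A v • c (insert v A) +
      ∑ x ∈ N \ insert u (insert v A), faceSign A x • c (insert x A) := by
  have h : N \ A = insert u (insert v (N \ insert u (insert v A))) := by
    ext x
    simp only [Finset.mem_sdiff, Finset.mem_insert, not_or]
    constructor
    · rintro ⟨h1, h2⟩
      by_cases hx : x = v <;> by_cases hx' : x = u <;> simp_all
    · rintro (rfl | rfl | ⟨h1, h2, h3, h4⟩)
      · exact ⟨hu, huA⟩
      · exact ⟨hv, hvA⟩
      · exact ⟨h1, h4⟩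
  rw [bd, h, Finset.sum_insert (by simp [huv]), Finset.sum_insert (by simp), add_assoc]

/-- The push-forward of a chain along the contraction of `v` to `u`. A face containing both is
annihilated; moving `v` to the place of `u` past the vertices of `A` costs the sign
`faceSign A u * faceSign A v`. -/
def contract (u v : V) (c : Finset V → Γ) (F : Finset V) : Γ :=
  if v ∈ F then 0
  else if u ∈ F then
    c F + (faceSign (F.erase u) u * faceSign (F.erase u) v) • c (insert v (F.erase u))
  else c F

theorem contract_of_mem {F : Finset V} (h : v ∈ F) (c : Finset V → Γ) : contract u v c F = 0 :=
  if_pos h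

theorem contract_avoiding (huA : u ∉ A) (hvA : v ∉ A) (c : Finset V → Γ) :
    contract u v c A = c A := by
  rw [contract, if_neg hvA, if_neg huA]

theorem contract_insert (huv : u ≠ v) (huA : u ∉ A) (hvA : v ∉ A) (c : Finset V → Γ) :
    contract u v c (insert u A) =
      c (insert u A) + (faceSign A u * faceSign A v) • c (insert v A) := by
  rw [contract, if_neg (by simp [huv.symm, hvA]), if_pos (Finset.mem_insert_self _ _),
    Finset.erase_insert huA]

theorem bd_contract (huv : u ≠ v) (hu : u ∈ N) (hv : v ∈ N) (c : Finset V → Γ) :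
    bd N (contract u v c) = contract u v (bd N c) := by
  ext G
  by_cases hvG : v ∈ G
  · rw [contract_of_mem hvG]
    exact Finset.sum_eq_zero fun x _ => by
      rw [contract_of_mem (Finset.mem_insert_of_mem hvG), smul_zero]
  by_cases huG : u ∈ G
  · obtain ⟨A, huA, rfl⟩ : ∃ A, u ∉ A ∧ G = insert u A :=
      ⟨G.erase u, by simp, (Finset.insert_erase huG).symm⟩
    have hvA : v ∉ A := fun h => hvG (Finset.mem_insert_of_mem h)
    rw [contract_insert huv huA hvA, bd_insert_left huv hv hvA, bd_insert_left huv hv hvA,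
      bd_insert_right huv hu huA, contract_of_mem (by simp), smul_zero, zero_add, smul_add,
      add_add_add_comm, Finset.smul_sum, ← Finset.sum_add_distrib, smul_smul, ← add_smul]
    have h0 : faceSign (insert u A) v + faceSign A u * faceSign A v * faceSign (insert v A) u
        = 0 := by
      rw [faceSign_insert huA, faceSign_insert hvA, pairSign_swap huv.symm]
      linear_combination (-pairSign v u * faceSign A v) * faceSign_mul_self A u +
        2 * pairSign v u * faceSign A v * faceSign_mul_self A u
    rw [h0, zero_smul, zero_add]
    refine Finset.sum_congr rfl fun x hx => ?_
    simp only [Finset.mem_sdiff, Finset.mem_insert, not_or] at hx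
    obtain ⟨_, hxu, hxv, hxA⟩ := hx
    rw [contract_insert huv (by simp [huA, Ne.symm hxu]) (by simp [hvA, Ne.symm hxv]), smul_add,
      smul_smul, smul_smul]
    congr 2
    rw [faceSign_insert huA, faceSign_insert hvA, faceSign_insert hxA, faceSign_insert hxA,
      pairSign_swap hxu, pairSign_swap hxv]
    linear_combination (-pairSign x v * faceSign A x * faceSign A u * faceSign A v) *
      pairSign_mul_self x u
  · rw [contract_avoiding huG hvG, bd_avoiding huv hu hv huG hvG, bd_avoiding huv hu hv huG hvG,
      contract_insert huv huG hvG, contract_of_mem (by simp), smul_zero, add_zero, smul_add,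
      smul_smul, ← mul_assoc, faceSign_mul_self, one_mul]
    congr 1
    refine Finset.sum_congr rfl fun x hx => ?_
    simp only [Finset.mem_sdiff, Finset.mem_insert, not_or] at hx
    rw [contract_avoiding (by simp [huG, Ne.symm hx.2.1]) (by simp [hvG, Ne.symm hx.2.2.1])]

/-- The image of a face under the contraction of `v` to `u`. -/
def contractFace (u v : V) (F : Finset V) : Finset V :=
  if v ∈ F then insert u (F.erase v) else F

theorem contractFace_insert (hvA : v ∉ A) : contractFace u v (insert v A) = insert u A := by
  rw [contractFace, if_pos (Finset.mem_insert_self _ _), Finset.erase_insert hvA]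

theorem contractFace_of_notMem (hvA : v ∉ A) : contractFace u v A = A := if_neg hvA

theorem contract_indicator (huv : u ≠ v) (S : Set (Finset V)) (c : Finset V → Γ) :
    contract u v ((contractFace u v ⁻¹' S).indicator c) = S.indicator (contract u v c) := by
  classical
  ext G
  by_cases hvG : v ∈ G
  · simp [contract_of_mem hvG, Set.indicator_apply]
  by_cases huG : u ∈ G
  · obtain ⟨A, huA, rfl⟩ : ∃ A, u ∉ A ∧ G = insert u A :=
      ⟨G.erase u, by simp, (Finset.insert_erase huG).symm⟩
    have hvA : v ∉ A := fun h => hvG (Finset.mem_insert_of_mem h)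
    simp only [contract_insert huv huA hvA, Set.indicator_apply, Set.mem_preimage,
      contractFace_insert hvA, contractFace_of_notMem hvG]
    split_ifs <;> simp
  · simp [contract_avoiding huG hvG, Set.indicator_apply, contractFace_of_notMem hvG]

theorem contract_ne_zero_imp {F : Finset V} {c : Finset V → Γ} (h : contract u v c F ≠ 0) :
    v ∉ F ∧ ∃ F', c F' ≠ 0 ∧ contractFace u v F' = F ∧ ¬(u ∈ F' ∧ v ∈ F') := by
  have hvF : v ∉ F := fun hv => h (contract_of_mem hv c)
  refine ⟨hvF, ?_⟩
  by_cases h1 : c F ≠ 0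
  · exact ⟨F, h1, contractFace_of_notMem hvF, fun h => hvF h.2⟩
  rw [not_not] at h1
  by_cases huF : u ∈ F
  · refine ⟨insert v (F.erase u), fun h2 => h ?_, ?_, ?_⟩
    · rw [contract, if_neg hvF, if_pos huF, h1, h2, smul_zero, add_zero]
    · rw [contractFace_insert (fun h => hvF (Finset.mem_of_mem_erase h)), Finset.insert_erase huF]
    · rintro ⟨h3, -⟩
      rcases Finset.mem_insert.mp h3 with rfl | h3
      · exact hvF huF
      · exact absurd rfl (Finset.ne_of_mem_erase h3)
  · exact absurd (by rw [contract_avoiding huF hvF, h1]) h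

end Contraction

section MinimalCycles

/-- A cycle no proper nonzero restriction of which is a cycle. -/
def IsMinimalOn (N : Finset V) (c : Finset V → Γ) : Prop :=
  bd N c = 0 ∧ ∀ S : Set (Finset V), bd N (S.indicator c) = 0 → S.indicator c = c ∨
    S.indicator c = 0

theorem exists_indicator_isMinimalOn (N : Finset V) {c : Finset V → Γ} (hc : bd N c = 0)
    (hne : c ≠ 0) (hfin : c.support.Finite) :
    ∃ S : Set (Finset V), S.indicator c ≠ 0 ∧ IsMinimalOn N (S.indicator c) := by
  induction hn : c.support.ncard using Nat.strong_induction_on generalizing c with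
  | _ n ih =>
    subst hn
    by_cases hmin : IsMinimalOn N c
    · exact ⟨Set.univ, by rwa [Set.indicator_univ], by rwa [Set.indicator_univ]⟩
    · have : ∃ S : Set (Finset V), bd N (S.indicator c) = 0 ∧ S.indicator c ≠ c ∧
          S.indicator c ≠ 0 := by
        by_contra! h
        exact hmin ⟨hc, fun S hS => or_iff_not_imp_left.mpr (h S hS)⟩
      obtain ⟨S, hS, h1, h2⟩ := this
      have hss : (S.indicator c).support ⊂ c.support := by
        rw [Set.support_indicator]
        refine ⟨Set.inter_subset_right, fun h => h1 ?_⟩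
        exact Set.indicator_eq_self.mpr fun F hF => (h hF).1
      obtain ⟨T, hT, hT'⟩ := ih _ (Set.ncard_lt_ncard hss hfin) hS h2 (hfin.subset hss.1) rfl
      rw [Set.indicator_indicator] at hT hT'
      exact ⟨T ∩ S, hT, hT'⟩

end MinimalCycles

section Coherence

variable {N : Finset V} {u v : V} {Z : Set (Finset V)}

/-- The boundary of the part of `y` in `Z` agrees, at the faces `insert u B` and `insert v B`, with
the boundary of `y` or with `0`, according as `insert u (insert v B)` is in `Z` or not, and it has
no faces avoiding both `u` and `v`. This condition is additive in `y`, and for a cycle `y` it forces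
the part of `y` in `Z` to be a cycle. -/
def IsCoherent (N : Finset V) (u v : V) (Z : Set (Finset V)) (y : Finset V → Γ) : Prop :=
  ∀ B, u ∉ B → v ∉ B → bd N (Z.indicator y) B = 0 ∧
    (insert u (insert v B) ∈ Z →
      bd N (Z.indicator y) (insert u B) = bd N y (insert u B) ∧
      bd N (Z.indicator y) (insert v B) = bd N y (insert v B)) ∧
    (insert u (insert v B) ∉ Z →
      bd N (Z.indicator y) (insert u B) = 0 ∧ bd N (Z.indicator y) (insert v B) = 0)

theorem IsCoherent.add {y y' : Finset V → Γ} (h : IsCoherent N u v Z y)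
    (h' : IsCoherent N u v Z y') : IsCoherent N u v Z (y + y') := by
  intro B hu hv
  obtain ⟨h1, h2, h3⟩ := h B hu hv
  obtain ⟨h1', h2', h3'⟩ := h' B hu hv
  simp only [Set.indicator_add', bd_add, Pi.add_apply]
  refine ⟨by rw [h1, h1', add_zero], fun hZ => ?_, fun hZ => ?_⟩
  · rw [(h2 hZ).1, (h2 hZ).2, (h2' hZ).1, (h2' hZ).2]
    exact ⟨rfl, rfl⟩
  · rw [(h3 hZ).1, (h3 hZ).2, (h3' hZ).1, (h3' hZ).2, add_zero]
    exact ⟨rfl, rfl⟩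

theorem isCoherent_zero : IsCoherent N u v Z (0 : Finset V → Γ) := by
  intro B _ _
  simp [Set.indicator_zero', bd_zero]

theorem isCoherent_of_forall_mem {y : Finset V → Γ} (huv : u ≠ v) (hu : u ∈ N) (hv : v ∈ N)
    (hy : ∀ F, y F ≠ 0 → u ∈ F ∧ v ∈ F) : IsCoherent N u v Z y := by
  classical
  have hz : ∀ F, ¬(u ∈ F ∧ v ∈ F) → y F = 0 := fun F hF => by_contra fun h => hF (hy F h)
  intro B huB hvB
  have hl : ∀ z : Finset V → Γ, (∀ F, ¬(u ∈ F ∧ v ∈ F) → z F = 0) → bd N z (insert u B) =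
      faceSign (insert u B) v • z (insert u (insert v B)) := by
    intro z hz
    rw [bd_insert_left huv hv hvB, Finset.sum_eq_zero, add_zero]
    intro x hx
    simp only [Finset.mem_sdiff, Finset.mem_insert, not_or] at hx
    rw [hz _ (by simp [huv.symm, hvB, Ne.symm hx.2.2.1]), smul_zero]
  have hr : ∀ z : Finset V → Γ, (∀ F, ¬(u ∈ F ∧ v ∈ F) → z F = 0) → bd N z (insert v B) =
      faceSign (insert v B) u • z (insert u (insert v B)) := by
    intro z hz
    rw [bd_insert_right huv hu huB, Finset.sum_eq_zero, add_zero]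
    intro x hx
    simp only [Finset.mem_sdiff, Finset.mem_insert, not_or] at hx
    rw [hz _ (by simp [huv, huB, Ne.symm hx.2.1]), smul_zero]
  have hz' : ∀ F, ¬(u ∈ F ∧ v ∈ F) → Z.indicator y F = 0 := fun F hF => by
    simp [Set.indicator_apply, hz F hF]
  rw [hl _ hz, hl _ hz', hr _ hz, hr _ hz']
  refine ⟨?_, fun hZ => by simp [hZ], fun hZ => by simp [hZ]⟩
  refine Finset.sum_eq_zero fun x _ => ?_
  rw [hz' _ ?_, smul_zero]
  rintro ⟨h1, h2⟩
  have e1 := (Finset.mem_insert.mp h1).resolve_right huB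
  have e2 := (Finset.mem_insert.mp h2).resolve_right hvB
  exact huv (e1.trans e2.symm)

theorem bd_eq_zero_of_contract {y : Finset V → Γ} (huv : u ≠ v)
    (hy : contract u v (bd N y) = 0) {B : Finset V} (huB : u ∉ B) (hvB : v ∉ B) :
    bd N y B = 0 ∧ (bd N y (insert u B) = 0 ↔ bd N y (insert v B) = 0) := by
  have h1 := congrFun hy B
  have h2 := congrFun hy (insert u B)
  rw [contract_avoiding huB hvB, Pi.zero_apply] at h1
  rw [contract_insert huv huB hvB, Pi.zero_apply] at h2
  refine ⟨h1, fun h => ?_, fun h => ?_⟩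
  · rw [h, zero_add, mul_smul] at h2
    exact faceSign_smul_eq_zero (faceSign_smul_eq_zero h2)
  · rwa [h, smul_zero, add_zero] at h2

/-- A chain whose contraction is a cycle is coherent if `Z` cannot separate its faces from each
other, nor from the faces `insert u (insert v B)` that would close its boundary. -/
theorem isCoherent_of_all_or_none {y : Finset V → Γ} (huv : u ≠ v)
    (hy : contract u v (bd N y) = 0)
    (hface : ∀ F, y F ≠ 0 → F ∈ Z → (∀ F', y F' ≠ 0 → F' ∈ Z) ∧
      ∀ B, u ∉ B → v ∉ B → bd N y (insert u B) ≠ 0 → insert u (insert v B) ∈ Z)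
    (hbd : ∀ B, u ∉ B → v ∉ B → bd N y (insert u B) ≠ 0 → insert u (insert v B) ∈ Z →
      ∀ F, y F ≠ 0 → F ∈ Z) : IsCoherent N u v Z y := by
  by_cases h0 : ∃ F, y F ≠ 0 ∧ F ∈ Z
  · obtain ⟨F, hF, hFZ⟩ := h0
    obtain ⟨hall, hB⟩ := hface F hF hFZ
    have hself : Z.indicator y = y := Set.indicator_eq_self.mpr fun F' hF' => hall F' hF'
    intro B huB hvB
    obtain ⟨h1, h2⟩ := bd_eq_zero_of_contract huv hy huB hvB
    rw [hself]
    refine ⟨h1, fun _ => ⟨rfl, rfl⟩, fun hZ => ?_⟩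
    have h3 : bd N y (insert u B) = 0 := by_contra fun h => hZ (hB B huB hvB h)
    exact ⟨h3, h2.mp h3⟩
  · push Not at h0
    have hself : Z.indicator y = 0 := Set.indicator_eq_zero.mpr <|
      Set.disjoint_left.mpr fun F hF hFZ => h0 F hF hFZ
    intro B huB hvB
    obtain ⟨-, h2⟩ := bd_eq_zero_of_contract huv hy huB hvB
    rw [hself, bd_zero]
    refine ⟨rfl, fun hZ => ?_, fun _ => ⟨rfl, rfl⟩⟩
    have h3 : bd N y (insert u B) = 0 := by
      by_contra h
      obtain ⟨x, -, -, hx⟩ := exists_of_bd_ne_zero h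
      exact h0 _ hx (hbd B huB hvB h hZ _ hx)
    rw [h3, h2.mp h3]
    exact ⟨rfl, rfl⟩

theorem IsCoherent.bd_indicator_eq_zero {c : Finset V → Γ} (h : IsCoherent N u v Z c)
    (huv : u ≠ v) (hv : v ∈ N) (hc : bd N c = 0) : bd N (Z.indicator c) = 0 := by
  set f := bd N (Z.indicator c) with hf
  have hu' : ∀ B, u ∉ B → v ∉ B → f (insert u B) = 0 ∧ f (insert v B) = 0 := by
    intro B huB hvB
    obtain ⟨-, h2, h3⟩ := h B huB hvB
    by_cases hZ : insert u (insert v B) ∈ Z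
    · rw [hf, (h2 hZ).1, (h2 hZ).2, hc]
      exact ⟨rfl, rfl⟩
    · exact h3 hZ
  ext G
  rw [Pi.zero_apply]
  by_cases huG : u ∈ G
  · obtain ⟨B, huB, rfl⟩ : ∃ B, u ∉ B ∧ G = insert u B :=
      ⟨G.erase u, by simp, (Finset.insert_erase huG).symm⟩
    by_cases hvB : v ∈ B
    · obtain ⟨A, hvA, rfl⟩ : ∃ A, v ∉ A ∧ B = insert v A :=
        ⟨B.erase v, by simp, (Finset.insert_erase hvB).symm⟩
      have huA : u ∉ A := fun h => huB (Finset.mem_insert_of_mem h)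
      -- the boundary of `f` at `insert u A` has a single term that is not known to vanish
      have hff : bd N f (insert u A) = 0 := congrFun (bd_bd N _) _
      rw [bd_insert_left huv hv hvA, Finset.sum_eq_zero, add_zero] at hff
      · exact faceSign_smul_eq_zero hff
      · intro x hx
        simp only [Finset.mem_sdiff, Finset.mem_insert, not_or] at hx
        rw [(hu' _ _ _).1, smul_zero]
        · simp [huA, Ne.symm hx.2.1]
        · simp [hvA, Ne.symm hx.2.2.1]
    · exact (hu' B huB hvB).1
  · by_cases hvG : v ∈ G
    · obtain ⟨B, hvB, rfl⟩ : ∃ B, v ∉ B ∧ G = insert v B :=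
        ⟨G.erase v, by simp, (Finset.insert_erase hvG).symm⟩
      exact (hu' B (fun h => huG (Finset.mem_insert_of_mem h)) hvB).2
    · exact (h G huG hvG).1

/-- Fogelsanger's decomposition. The faces of `y` are grouped according to a splitting of the
contraction of `y` into minimal cycles; faces whose images cancel are grouped in pairs. -/
theorem isCoherent_of_pieces (huv : u ≠ v) (c : Finset V → Γ) (hfin : c.support.Finite)
    (hmin : ∀ S : Set (Finset V), (∀ F, S.indicator c F ≠ 0 → ¬(u ∈ F ∧ v ∈ F)) →
      contract u v (S.indicator c) ≠ 0 → IsMinimalOn N (contract u v (S.indicator c)) →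
      (∀ F, S.indicator c F ≠ 0 → contract u v (S.indicator c) (contractFace u v F) ≠ 0) →
      IsCoherent N u v Z (S.indicator c))
    (hpair : ∀ (S : Set (Finset V)) (A : Finset V), u ∉ A → v ∉ A →
      (∀ F, S.indicator c F ≠ 0 → F = insert u A ∨ F = insert v A) →
      contract u v (S.indicator c) = 0 → IsCoherent N u v Z (S.indicator c))
    (S : Set (Finset V)) (hS : ∀ F, S.indicator c F ≠ 0 → ¬(u ∈ F ∧ v ∈ F))
    (hcyc : bd N (contract u v (S.indicator c)) = 0) : IsCoherent N u v Z (S.indicator c) := by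
  induction hn : (S.indicator c).support.ncard using Nat.strong_induction_on generalizing S with
  | _ n ih =>
    subst hn
    set y := S.indicator c with hy
    have hyfin : y.support.Finite := by
      rw [hy, Set.support_indicator]
      exact hfin.subset Set.inter_subset_right
    rcases eq_or_ne y 0 with h0 | h0
    · rw [h0]; exact isCoherent_zero
    -- a group of faces, given by the set `T` of their images
    obtain ⟨T, hT, hTcyc, hTcoh⟩ : ∃ T : Set (Finset V),
        (contractFace u v ⁻¹' T).indicator y ≠ 0 ∧ bd N (T.indicator (contract u v y)) = 0 ∧
        IsCoherent N u v Z ((contractFace u v ⁻¹' T).indicator y) := by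
      by_cases hcy : contract u v y = 0
      · obtain ⟨F, hF⟩ := Function.ne_iff.mp h0
        rw [Pi.zero_apply] at hF
        obtain ⟨A, huA, hvA, hFA⟩ : ∃ A, u ∉ A ∧ v ∉ A ∧ contractFace u v F = insert u A := by
          by_cases hvF : v ∈ F
          · refine ⟨F.erase v, fun h => hS F hF ⟨Finset.mem_of_mem_erase h, hvF⟩, by simp, ?_⟩
            rw [contractFace, if_pos hvF]
          · by_cases huF : u ∈ F
            · refine ⟨F.erase u, by simp, fun h => hvF (Finset.mem_of_mem_erase h), ?_⟩
              rw [contractFace_of_notMem hvF, Finset.insert_erase huF]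
            · exact absurd (by rw [← contract_avoiding huF hvF y, hcy, Pi.zero_apply]) hF
        refine ⟨{insert u A}, ?_, ?_, ?_⟩
        · refine Function.ne_iff.mpr ⟨F, ?_⟩
          rw [Set.indicator_of_mem (by simpa using hFA)]
          exact hF
        · rw [hcy, Set.indicator_zero', bd_zero]
        · have h1 : contract u v ((contractFace u v ⁻¹' {insert u A}).indicator y) = 0 := by
            rw [contract_indicator huv, hcy, Set.indicator_zero']
          rw [hy, Set.indicator_indicator] at h1 ⊢
          refine hpair _ A huA hvA (fun F' hF' => ?_) h1
          have hmem := (Set.indicator_apply_ne_zero.mp hF').1.1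
          simp only [Set.mem_preimage, Set.mem_singleton_iff, contractFace] at hmem
          split_ifs at hmem with hvF'
          · right
            have huF' : u ∉ F' := fun h => hS F' (Set.indicator_apply_ne_zero.mpr
              ⟨(Set.indicator_apply_ne_zero.mp hF').1.2,
                (Set.indicator_apply_ne_zero.mp hF').2⟩) ⟨h, hvF'⟩
            rw [← Finset.insert_erase hvF']
            congr 1
            have := congrArg (fun G => G.erase u) hmem
            simpa [Finset.erase_insert huA, huF'] using this
          · exact Or.inl hmem
      · have hcfin : (contract u v y).support.Finite := by
          refine (hyfin.image (contractFace u v)).subset fun F hF => ?_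
          obtain ⟨-, F', h1, h2, -⟩ := contract_ne_zero_imp hF
          exact ⟨F', h1, h2⟩
        obtain ⟨T, hT, hTmin⟩ := exists_indicator_isMinimalOn N hcyc hcy hcfin
        rw [← Set.indicator_inter_support] at hT hTmin
        set T' := T ∩ (contract u v y).support with hT'
        have hcontr := contract_indicator huv T' y
        have hsub : ∀ F, (contractFace u v ⁻¹' T').indicator y F ≠ 0 → contractFace u v F ∈ T' ∧
            y F ≠ 0 := fun F hF => Set.indicator_apply_ne_zero.mp hF
        refine ⟨T', fun h => hT ?_, hTmin.1, ?_⟩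
        · rw [← hcontr, h]
          ext F
          simp [contract]
        · have hsub' : ∀ F, (contractFace u v ⁻¹' T').indicator y F ≠ 0 →
              contract u v ((contractFace u v ⁻¹' T').indicator y) (contractFace u v F) ≠ 0 := by
            intro F hF
            rw [hcontr, Set.indicator_of_mem (hsub F hF).1]
            exact (hsub F hF).1.2
          rw [← hcontr] at hT hTmin
          rw [hy, Set.indicator_indicator] at hT hTmin hsub hsub' ⊢
          exact hmin _ (fun F hF => hS F (hsub F hF).2) hT hTmin hsub'
    have hsplit : y = (contractFace u v ⁻¹' T).indicator y + (contractFace u v ⁻¹' T)ᶜ.indicator y :=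
      (Set.indicator_self_add_compl _ _).symm
    rw [hsplit]
    refine hTcoh.add ?_
    have hrest : (contractFace u v ⁻¹' T)ᶜ.indicator y =
        ((contractFace u v ⁻¹' T)ᶜ ∩ S).indicator c := by
      rw [hy, Set.indicator_indicator]
    rw [hrest]
    refine ih _ ?_ _ ?_ ?_ rfl
    · rw [← hrest]
      refine Set.ncard_lt_ncard ?_ hyfin
      rw [Set.support_indicator]
      refine ⟨Set.inter_subset_right, fun h => hT ?_⟩
      refine Set.indicator_eq_zero.mpr (Set.disjoint_left.mpr fun F hF hFT => ?_)
      exact (h hF).1 hFT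
    · rw [← hrest]
      exact fun F hF => hS F (Set.indicator_apply_ne_zero.mp hF).2
    · rw [← hrest, ← Set.preimage_compl, contract_indicator huv]
      have h2 := congrArg (bd N) (Set.indicator_self_add_compl T (contract u v y))
      rwa [bd_add, hTcyc, hcyc, zero_add] at h2

theorem bd_indicator_eq_zero_of_pieces (huv : u ≠ v) (hu : u ∈ N) (hv : v ∈ N)
    (c : Finset V → Γ) (hfin : c.support.Finite) (hc : bd N c = 0)
    (hmin : ∀ S : Set (Finset V), (∀ F, S.indicator c F ≠ 0 → ¬(u ∈ F ∧ v ∈ F)) →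
      contract u v (S.indicator c) ≠ 0 → IsMinimalOn N (contract u v (S.indicator c)) →
      (∀ F, S.indicator c F ≠ 0 → contract u v (S.indicator c) (contractFace u v F) ≠ 0) →
      IsCoherent N u v Z (S.indicator c))
    (hpair : ∀ (S : Set (Finset V)) (A : Finset V), u ∉ A → v ∉ A →
      (∀ F, S.indicator c F ≠ 0 → F = insert u A ∨ F = insert v A) →
      contract u v (S.indicator c) = 0 → IsCoherent N u v Z (S.indicator c)) :
    bd N (Z.indicator c) = 0 := by
  refine IsCoherent.bd_indicator_eq_zero (u := u) (v := v) ?_ huv hv hc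
  set S : Set (Finset V) := {F | u ∈ F ∧ v ∈ F} with hS
  rw [← Set.indicator_self_add_compl S c]
  refine IsCoherent.add (isCoherent_of_forall_mem huv hu hv fun F hF =>
    (Set.indicator_apply_ne_zero.mp hF).1) ?_
  refine isCoherent_of_pieces huv c hfin hmin hpair Sᶜ (fun F hF =>
    (Set.indicator_apply_ne_zero.mp hF).1) ?_
  have : contract u v (Sᶜ.indicator c) = contract u v c := by
    ext G
    by_cases hvG : v ∈ G
    · rw [contract_of_mem hvG, contract_of_mem hvG]
    by_cases huG : u ∈ G
    · obtain ⟨A, huA, rfl⟩ : ∃ A, u ∉ A ∧ G = insert u A :=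
        ⟨G.erase u, by simp, (Finset.insert_erase huG).symm⟩
      have hvA : v ∉ A := fun h => hvG (Finset.mem_insert_of_mem h)
      rw [contract_insert huv huA hvA, contract_insert huv huA hvA,
        Set.indicator_of_mem (by simp [hS, huv.symm, hvA]),
        Set.indicator_of_mem (by simp [hS, huv, huA])]
    · rw [contract_avoiding huG hvG, contract_avoiding huG hvG,
        Set.indicator_of_mem (by simp [hS, huG])]
  rw [this, bd_contract huv hu hv, hc]
  ext F
  simp [contract]

end Coherence

end SimplicialChain

/-! ### Rigidity of minimal cycles -/

namespace SimplicialChain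

section Support

variable {V Γ : Type*} [AddCommGroup Γ]

/-- The relation of lying in a common face of the support of `c`; off the diagonal this is the
adjacency of the graph of the complex spanned by the support. -/
def supportEdge (c : Finset V → Γ) (x y : V) : Prop := ∃ F, c F ≠ 0 ∧ x ∈ F ∧ y ∈ F

open Classical in
/-- The vertices of the support of `c` that lie in `U`. -/
noncomputable def supportVertices (U : Finset V) (c : Finset V → Γ) : Finset V :=
  U.filter fun x => ∃ F, c F ≠ 0 ∧ x ∈ F

theorem mem_supportVertices {U : Finset V} {c : Finset V → Γ} {x : V} :
    x ∈ supportVertices U c ↔ x ∈ U ∧ ∃ F, c F ≠ 0 ∧ x ∈ F := by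
  simp [supportVertices]

end Support

variable {V Γ : Type*} [LinearOrder V] [AddCommGroup Γ] {k : ℕ}

section Pieces

variable {N U B : Finset V} {u v : V} {y : Finset V → Γ}

theorem exists_face_of_bd_ne_zero (hyk : ∀ F, y F ≠ 0 → k ≤ (F ∩ U).card)
    (h : bd N y (insert u B) ≠ 0) :
    (∃ F, y F ≠ 0 ∧ insert u B ⊆ F) ∧ k ≤ (B ∩ U).card + 2 := by
  obtain ⟨x, -, -, hx⟩ := exists_of_bd_ne_zero h
  refine ⟨⟨_, hx, Finset.subset_insert _ _⟩, (hyk _ hx).trans ?_⟩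
  have hsub : insert x (insert u B) ∩ U ⊆ insert x (insert u (B ∩ U)) := by
    intro z
    simp only [Finset.mem_inter, Finset.mem_insert]
    tauto
  calc _ ≤ (insert x (insert u (B ∩ U))).card := Finset.card_le_card hsub
    _ ≤ (insert u (B ∩ U)).card + 1 := Finset.card_insert_le _ _
    _ ≤ _ := by have := Finset.card_insert_le u (B ∩ U); omega

theorem le_card_insert_insert_inter (huv : u ≠ v) (hu : u ∈ U) (hv : v ∈ U) (huB : u ∉ B)
    (hvB : v ∉ B) : (B ∩ U).card + 2 ≤ (insert u (insert v B) ∩ U).card := by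
  rw [Finset.insert_inter_of_mem hu, Finset.insert_inter_of_mem hv, Finset.card_insert_of_notMem,
    Finset.card_insert_of_notMem] <;> simp [huv, huB, hvB]

theorem exists_bd_insert_ne_zero (huv : u ≠ v) (hyuv : ∀ F, y F ≠ 0 → ¬(u ∈ F ∧ v ∈ F))
    (hy : contract u v (bd N y) = 0) (hne : bd N y ≠ 0) :
    ∃ B, u ∉ B ∧ v ∉ B ∧ bd N y (insert u B) ≠ 0 := by
  obtain ⟨G, hG⟩ := Function.ne_iff.mp hne
  rw [Pi.zero_apply] at hG
  have hboth : ¬(u ∈ G ∧ v ∈ G) := by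
    obtain ⟨x, -, -, hx⟩ := exists_of_bd_ne_zero hG
    exact fun h => hyuv _ hx ⟨Finset.mem_insert_of_mem h.1, Finset.mem_insert_of_mem h.2⟩
  by_cases huG : u ∈ G
  · refine ⟨G.erase u, by simp, fun h => hboth ⟨huG, Finset.mem_of_mem_erase h⟩, ?_⟩
    rwa [Finset.insert_erase huG]
  by_cases hvG : v ∈ G
  · have huB : u ∉ G.erase v := fun h => huG (Finset.mem_of_mem_erase h)
    have hvB : v ∉ G.erase v := by simp
    refine ⟨G.erase v, huB, hvB, fun h => hG ?_⟩
    have := (bd_eq_zero_of_contract huv hy huB hvB).2.mp h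
    rwa [Finset.insert_erase hvG] at this
  · exact absurd (bd_eq_zero_of_contract huv hy huG hvG).1 hG

/-- The endpoints of the contracted edge have `k - 1` common neighbours in `U`. A face
`insert u B` of the boundary of `y` gives at least `k - 2` of them, the vertices of `B ∩ U`. If
there is no other, then removing one of them from `B` leads, as the boundary of `bd N y` vanishes,
to a second face `insert u (insert x (B.erase w))` with `x ∈ U`. -/
theorem exists_common_neighbours (hk : 3 ≤ k) (huv : u ≠ v) (hv : v ∈ N)
    (hyN : ∀ F, y F ≠ 0 → F ⊆ N) (hyk : ∀ F, y F ≠ 0 → k ≤ (F ∩ U).card)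
    (hyuv : ∀ F, y F ≠ 0 → ¬(u ∈ F ∧ v ∈ F))
    (hy : contract u v (bd N y) = 0) (hne : bd N y ≠ 0) :
    ∃ C ⊆ U, u ∉ C ∧ v ∉ C ∧ C.card + 1 = k ∧ (∀ x ∈ C, supportEdge y u x) ∧
      ∀ x ∈ C, supportEdge y v x := by
  obtain ⟨B, huB, hvB, hB⟩ := exists_bd_insert_ne_zero huv hyuv hy hne
  have hnbr : ∀ B, u ∉ B → v ∉ B → bd N y (insert u B) ≠ 0 → ∀ x ∈ B,
      supportEdge y u x ∧ supportEdge y v x := by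
    intro B huB hvB hB x hx
    obtain ⟨F, hF, hBF⟩ := (exists_face_of_bd_ne_zero hyk hB).1
    obtain ⟨F', hF', hBF'⟩ := (exists_face_of_bd_ne_zero hyk
      (mt (bd_eq_zero_of_contract huv hy huB hvB).2.mpr hB)).1
    exact ⟨⟨F, hF, hBF (Finset.mem_insert_self _ _), hBF (Finset.mem_insert_of_mem hx)⟩,
      ⟨F', hF', hBF' (Finset.mem_insert_self _ _), hBF' (Finset.mem_insert_of_mem hx)⟩⟩
  have hcard := (exists_face_of_bd_ne_zero hyk hB).2
  by_cases hcase : k ≤ (B ∩ U).card + 1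
  · obtain ⟨C, hCB, hC⟩ := Finset.exists_subset_card_eq (s := B ∩ U) (n := k - 1) (by omega)
    have hCB' : C ⊆ B := hCB.trans Finset.inter_subset_left
    exact ⟨C, hCB.trans Finset.inter_subset_right, fun h => huB (hCB' h), fun h => hvB (hCB' h),
      by omega, fun x hx => (hnbr B huB hvB hB x (hCB' hx)).1,
      fun x hx => (hnbr B huB hvB hB x (hCB' hx)).2⟩
  · obtain ⟨w, hw⟩ : (B ∩ U).Nonempty := Finset.card_pos.mp (by omega)
    obtain ⟨hwB, hwU⟩ := Finset.mem_inter.mp hw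
    have hwu : w ≠ u := fun h => huB (h ▸ hwB)
    have hwv : w ≠ v := fun h => hvB (h ▸ hwB)
    set A := B.erase w with hA
    have huA : u ∉ A := fun h => huB (Finset.mem_of_mem_erase h)
    have hvA : v ∉ A := fun h => hvB (Finset.mem_of_mem_erase h)
    have hwA : w ∉ A := by simp [hA]
    have hBA : B = insert w A := (Finset.insert_erase hwB).symm
    obtain ⟨x, hxw, hxv, hxu, hxA, hx⟩ : ∃ x, x ≠ w ∧ x ≠ v ∧ x ≠ u ∧ x ∉ A ∧
        bd N y (insert u (insert x A)) ≠ 0 := by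
      by_contra! hcon
      have hff : bd N (bd N y) (insert u A) = 0 := congrFun (bd_bd N _) _
      have hvanish : bd N y (insert u (insert v A)) = 0 := by
        by_contra h
        obtain ⟨x, -, -, hx⟩ := exists_of_bd_ne_zero h
        exact hyuv _ hx (by simp)
      obtain ⟨z, hz, -, hwz⟩ := exists_of_bd_ne_zero hB
      have hwN : w ∈ N := hyN _ hwz (by simp [hwB])
      rw [bd_insert_left huv hv hvA, hvanish, smul_zero, zero_add,
        Finset.sum_eq_single w] at hff
      · rw [← hBA] at hff
        exact hB (faceSign_smul_eq_zero hff)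
      · intro x hx hxw
        simp only [Finset.mem_sdiff, Finset.mem_insert, not_or] at hx
        rw [hcon x hxw hx.2.2.1 hx.2.1 hx.2.2.2, smul_zero]
      · intro h
        exact absurd (Finset.mem_sdiff.mpr ⟨hwN, by simp [hwu, hwv, hwA]⟩) h
    have hxU : x ∈ U := by
      by_contra hxU
      have h1 := (exists_face_of_bd_ne_zero hyk hx).2
      rw [Finset.insert_inter_of_notMem hxU] at h1
      rw [hBA, Finset.insert_inter_of_mem hwU, Finset.card_insert_of_notMem (by simp [hwA])]
        at hcase
      omega
    have hxB : x ∉ B := by simp [hBA, hxw, hxA]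
    have hnx := hnbr (insert x A) (by simp [huA, hxu.symm]) (by simp [hvA, hxv.symm]) hx x
      (Finset.mem_insert_self _ _)
    refine ⟨insert x (B ∩ U), ?_, by simp [hxu.symm, huB], by simp [hxv.symm, hvB], ?_, ?_, ?_⟩
    · exact Finset.insert_subset hxU Finset.inter_subset_right
    · rw [Finset.card_insert_of_notMem (by simp [hxB])]
      omega
    · intro z hz
      rcases Finset.mem_insert.mp hz with rfl | hz
      · exact hnx.1
      · exact (hnbr B huB hvB hB z (Finset.mem_inter.mp hz).1).1
    · intro z hz
      rcases Finset.mem_insert.mp hz with rfl | hz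
      · exact hnx.2
      · exact (hnbr B huB hvB hB z (Finset.mem_inter.mp hz).1).2

theorem mem_contractFace {F : Finset V} {x : V} (hx : x ∈ F) (hxv : x ≠ v) :
    x ∈ contractFace u v F := by
  rw [contractFace]
  split_ifs
  · exact Finset.mem_insert_of_mem (Finset.mem_erase.mpr ⟨hxv, hx⟩)
  · exact hx

theorem mem_of_mem_contractFace {F : Finset V} {x : V} (hx : x ∈ contractFace u v F)
    (hxu : x ≠ u) : x ∈ F := by
  rw [contractFace] at hx
  split_ifs at hx
  · exact Finset.mem_of_mem_erase ((Finset.mem_insert.mp hx).resolve_left hxu)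
  · exact hx

theorem mem_or_mem_of_mem_contractFace {F : Finset V} (hx : u ∈ contractFace u v F) :
    u ∈ F ∨ v ∈ F := by
  rw [contractFace] at hx
  split_ifs at hx with h
  · exact Or.inr h
  · exact Or.inl hx

theorem card_contractFace_inter {F : Finset V} (hu : u ∈ U) (hv : v ∈ U)
    (h : ¬(u ∈ F ∧ v ∈ F)) : (contractFace u v F ∩ U).card = (F ∩ U).card := by
  rw [contractFace]
  split_ifs with hvF
  · have huF : u ∉ F := fun hu => h ⟨hu, hvF⟩
    rw [Finset.insert_inter_of_mem hu, Finset.erase_inter, Finset.card_insert_of_notMem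
      (by simp [huF]), Finset.card_erase_add_one (Finset.mem_inter.mpr ⟨hvF, hv⟩)]
  · rfl

/-- The vertices of a piece in `U`, except `v`, remain vertices of its contraction. -/
theorem mem_insert_supportVertices (hcon : ∀ F, y F ≠ 0 → contract u v y (contractFace u v F) ≠ 0)
    {F : Finset V} (hF : y F ≠ 0) {x : V} (hx : x ∈ F) (hxU : x ∈ U) :
    x ∈ insert v (supportVertices U (contract u v y)) := by
  rcases eq_or_ne x v with rfl | hxv
  · exact Finset.mem_insert_self _ _
  · exact Finset.mem_insert_of_mem (mem_supportVertices.mpr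
      ⟨hxU, _, hcon F hF, mem_contractFace hx hxv⟩)

theorem mem_supportVertices_contract
    (hcon : ∀ F, y F ≠ 0 → contract u v y (contractFace u v F) ≠ 0) (huv : u ≠ v) (hu : u ∈ U)
    (hyuv : ∀ F, y F ≠ 0 → ¬(u ∈ F ∧ v ∈ F)) (hy : contract u v (bd N y) = 0)
    (hne : bd N y ≠ 0) : u ∈ supportVertices U (contract u v y) := by
  obtain ⟨B, -, -, hB⟩ := exists_bd_insert_ne_zero huv hyuv hy hne
  obtain ⟨x, -, -, hx⟩ := exists_of_bd_ne_zero hB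
  exact mem_supportVertices.mpr ⟨hu, _, hcon _ hx, mem_contractFace (by simp) huv⟩

/-- The graph of a piece, together with the contracted edge, is generically rigid if the graph of
its contraction is. -/
theorem eventually_isRigidOn_piece (hk : 3 ≤ k) (huv : u ≠ v) (hv : v ∈ N) (hu : u ∈ U)
    (hyN : ∀ F, y F ≠ 0 → F ⊆ N) (hyk : ∀ F, y F ≠ 0 → k ≤ (F ∩ U).card)
    (hyuv : ∀ F, y F ≠ 0 → ¬(u ∈ F ∧ v ∈ F))
    (hy : contract u v (bd N y) = 0) (hne : bd N y ≠ 0)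
    (hcon : ∀ F, y F ≠ 0 → contract u v y (contractFace u v F) ≠ 0)
    (hrigid : ∀ᶠ p in genericFilter V k,
      IsRigidOn (supportEdge (contract u v y)) (supportVertices U (contract u v y)) p) :
    ∀ᶠ p in genericFilter V k, IsRigidOn (fun x z => supportEdge y x z ∨ (x = u ∧ z = v))
      (insert v (supportVertices U (contract u v y))) p := by
  obtain ⟨C, hCU, huC, hvC, hC, hCu, hCv⟩ :=
    exists_common_neighbours hk huv hv hyN hyk hyuv hy hne
  obtain ⟨F, hF⟩ : ∃ F, y F ≠ 0 := by
    obtain ⟨B, -, -, hB⟩ := exists_bd_insert_ne_zero huv hyuv hy hne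
    obtain ⟨x, -, -, hx⟩ := exists_of_bd_ne_zero hB
    exact ⟨_, hx⟩
  obtain ⟨A, hAF, hA⟩ := Finset.exists_subset_card_eq (hyk F hF)
  have hAF' : ∀ x ∈ A, x ∈ F ∧ x ∈ U := fun x hx => Finset.mem_inter.mp (hAF hx)
  refine eventually_isRigidOn_of_vertex_split (C := C) (A := A) (u := u) hrigid
    (mem_supportVertices_contract hcon huv hu hyuv hy hne) ?_ ?_ ?_ ?_ (Or.inr ⟨rfl, rfl⟩) ?_ huC hC
    (fun x hx => Or.inl (hCu x hx)) (fun x hx => Or.inl (hCv x hx)) ?_ hA ?_ ?_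
  · intro h
    obtain ⟨-, G, hG, hvG⟩ := mem_supportVertices.mp h
    exact hG (contract_of_mem hvG y)
  · rintro x z ⟨G, hG, hx, hz⟩
    exact ⟨G, hG, hz, hx⟩
  · rintro x z ⟨G, hG, hx, hz⟩ - hxu hzu
    obtain ⟨-, G', hG', rfl, -⟩ := contract_ne_zero_imp hG
    exact Or.inl ⟨G', hG', mem_of_mem_contractFace hx hxu, mem_of_mem_contractFace hz hzu⟩
  · rintro x ⟨G, hG, hu, hx⟩ hxu
    obtain ⟨-, G', hG', rfl, -⟩ := contract_ne_zero_imp hG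
    have hx' := mem_of_mem_contractFace hx hxu
    rcases mem_or_mem_of_mem_contractFace hu with h | h
    · exact Or.inl (Or.inl ⟨G', hG', h, hx'⟩)
    · exact Or.inr (Or.inl ⟨G', hG', h, hx'⟩)
  · intro x hx
    obtain ⟨G, hG, -, hxG⟩ := hCu x hx
    exact (Finset.mem_insert.mp (mem_insert_supportVertices hcon hG hxG (hCU hx))).resolve_left
      fun h => hvC (h ▸ hx)
  · exact fun x hx => mem_insert_supportVertices hcon hF (hAF' x hx).1 (hAF' x hx).2
  · by_contra! h
    exact hyuv F hF ⟨(hAF' u h.1).1, (hAF' v h.2).1⟩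
  · exact fun x hx z hz _ => Or.inl ⟨F, hF, (hAF' x hx).1, (hAF' z hz).1⟩

end Pieces

/-- Fogelsanger's theorem for transversal sets: if every face of a nonzero minimal cycle has at
least `k ≥ 3` vertices in `U`, then the graph that it induces on `U` is generically rigid in
`ℝ^k`. -/
theorem eventually_isRigidOn_of_isMinimalOn (hk : 3 ≤ k) (N U M : Finset V) (hM : M ⊆ N)
    (c : Finset V → Γ) (hcM : ∀ F, c F ≠ 0 → F ⊆ M) (hck : ∀ F, c F ≠ 0 → k ≤ (F ∩ U).card)
    (hne : c ≠ 0) (hmin : IsMinimalOn N c) :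
    ∀ᶠ p in genericFilter V k, IsRigidOn (supportEdge c) (supportVertices U c) p := by
  induction M using Finset.strongInduction generalizing c with
  | H M ih =>
  obtain ⟨F₀, hF₀⟩ := Function.ne_iff.mp hne
  rw [Pi.zero_apply] at hF₀
  obtain ⟨u, hu₀, v, hv₀, huv⟩ := Finset.one_lt_card.mp (show 1 < (F₀ ∩ U).card by
    have := hck F₀ hF₀; omega)
  obtain ⟨huF, hu⟩ := Finset.mem_inter.mp hu₀
  obtain ⟨hvF, hv⟩ := Finset.mem_inter.mp hv₀
  have huN : u ∈ N := hM (hcM F₀ hF₀ huF)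
  have hvN : v ∈ N := hM (hcM F₀ hF₀ hvF)
  have hfin : c.support.Finite := M.powerset.finite_toSet.subset fun F hF => by
    simpa using hcM F hF
  let piece : (Finset V → Γ) → Prop := fun y => (∀ F, y F ≠ 0 → ¬(u ∈ F ∧ v ∈ F)) ∧
    contract u v y ≠ 0 ∧ IsMinimalOn N (contract u v y) ∧
    ∀ F, y F ≠ 0 → contract u v y (contractFace u v F) ≠ 0
  have hind : ∀ (S : Set (Finset V)) F, S.indicator c F ≠ 0 → c F ≠ 0 := fun S F hF =>
    (Set.indicator_apply_ne_zero.mp hF).2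
  have hbdy : ∀ y, piece y → contract u v (bd N y) = 0 := fun y hy => by
    rw [← bd_contract huv huN hvN, hy.2.2.1.1]
  -- a piece is not a cycle, since it lacks the face `F₀`
  have hbdne : ∀ S : Set (Finset V), piece (S.indicator c) → bd N (S.indicator c) ≠ 0 := by
    intro S hS h
    rcases hmin.2 S h with h1 | h1
    · exact hS.1 F₀ (by rwa [h1]) ⟨huF, hvF⟩
    · refine hS.2.1 ?_
      rw [h1]
      ext F
      simp [contract]
  have hpieces : ∀ S : Set (Finset V), piece (S.indicator c) → ∀ᶠ p in genericFilter V k,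
      IsRigidOn (fun x z => supportEdge (S.indicator c) x z ∨ (x = u ∧ z = v))
        (insert v (supportVertices U (contract u v (S.indicator c)))) p := by
    intro S hS
    refine eventually_isRigidOn_piece hk huv hvN hu
      (fun F hF => (hcM F (hind S F hF)).trans hM) (fun F hF => hck F (hind S F hF)) hS.1
      (hbdy _ hS) (hbdne S hS) hS.2.2.2 ?_
    refine ih (M.erase v) (Finset.erase_ssubset (hcM F₀ hF₀ hvF))
      ((Finset.erase_subset _ _).trans hM) _ ?_ ?_ hS.2.1 hS.2.2.1
    · intro F hF x hx
      obtain ⟨hvF', F', hF', rfl, -⟩ := contract_ne_zero_imp hF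
      refine Finset.mem_erase.mpr ⟨fun h => hvF' (h ▸ hx), ?_⟩
      rcases eq_or_ne x u with rfl | hxu
      · exact hcM F₀ hF₀ huF
      · exact hcM F' (hind S F' hF') (mem_of_mem_contractFace hx hxu)
    · intro F hF
      obtain ⟨-, F', hF', rfl, huvF'⟩ := contract_ne_zero_imp hF
      rw [card_contractFace_inter hu hv huvF']
      exact hck F' (hind S F' hF')
  have hall : ∀ᶠ p in genericFilter V k, ∀ y ∈ (fun S : Set (Finset V) => S.indicator c) ''
      {S | S ⊆ c.support}, piece y →
        IsRigidOn (fun x z => supportEdge y x z ∨ (x = u ∧ z = v))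
          (insert v (supportVertices U (contract u v y))) p := by
    rw [Filter.eventually_all_finite (hfin.finite_subsets.image _)]
    rintro _ ⟨S, -, rfl⟩
    by_cases hS : piece (S.indicator c)
    · filter_upwards [hpieces S hS] with p hp _ using hp
    · exact Filter.Eventually.of_forall fun p h => absurd h hS
  filter_upwards [hall, eventually_inGeneralPosition U] with p hp hgp
  intro q₀ hq₀
  have hmem : ∀ F, c F ≠ 0 → ∀ x ∈ F, x ∈ U → x ∈ supportVertices U c := fun F hF x hx hxU =>
    mem_supportVertices.mpr ⟨hxU, F, hF, hx⟩
  obtain ⟨A, hAF, hA⟩ := Finset.exists_subset_card_eq (hck F₀ hF₀)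
  have hAF' : ∀ x ∈ A, x ∈ F₀ ∧ x ∈ U := fun x hx => Finset.mem_inter.mp (hAF hx)
  obtain ⟨S₀, t, hS₀, hSt⟩ := hgp.exists_trivial_motion (fun x hx => (hAF' x hx).2) hA
    (q := q₀) fun x hx z hz => hq₀ x (hmem F₀ hF₀ x (hAF' x hx).1 (hAF' x hx).2) z
      (hmem F₀ hF₀ z (hAF' z hz).1 (hAF' z hz).2) ⟨F₀, hF₀, (hAF' x hx).1, (hAF' z hz).1⟩
  refine ⟨S₀, t, hS₀, ?_⟩
  -- subtracting a trivial motion yields a motion `q` that vanishes on `F₀ ∩ U`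
  set q : V → Fin k → ℝ := fun x => q₀ x - (S₀ *ᵥ p x + t) with hq
  suffices hzero : ∀ F, c F ≠ 0 → ∀ x ∈ F, x ∈ U → q x = 0 by
    intro x hx
    obtain ⟨hxU, F, hF, hxF⟩ := mem_supportVertices.mp hx
    exact sub_eq_zero.mp (hzero F hF x hxF hxU)
  have hmotion : ∀ x ∈ U, ∀ z ∈ U, supportEdge c x z → (p x - p z) ⬝ᵥ (q x - q z) = 0 := by
    intro x hx z hz hxz
    have hxz' := hxz
    obtain ⟨F, hF, hxF, hzF⟩ := hxz
    exact hq₀.sub_trivial hS₀ t x (hmem F hF x hxF hx) z (hmem F hF z hzF hz) hxz'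
  have hqA : ∀ x ∈ A, q x = 0 := fun x hx => sub_eq_zero.mpr (hSt x hx)
  have hF₀zero : ∀ x ∈ F₀, x ∈ U → q x = 0 := fun x hxF hx =>
    hgp.eq_zero_of_joined (fun z hz => (hAF' z hz).2) hA.ge hx hqA fun z hz =>
      hmotion x hx z (hAF' z hz).2 ⟨F₀, hF₀, hxF, (hAF' z hz).1⟩
  set Z : Set (Finset V) := {F | ∀ x ∈ F, x ∈ U → q x = 0} with hZ
  have hbdZ : bd N (Z.indicator c) = 0 := by
    refine bd_indicator_eq_zero_of_pieces huv huN hvN c hfin hmin.1 ?_ ?_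
    · intro S h1 h2 h3 h4
      have hS : piece (S.indicator c) := ⟨h1, h2, h3, h4⟩
      have hrig := hp (S.indicator c) ⟨S ∩ c.support, Set.inter_subset_right,
        Set.indicator_inter_support _ _⟩ hS
      have hyk : ∀ F, S.indicator c F ≠ 0 → k ≤ (F ∩ U).card := fun F hF => hck F (hind S F hF)
      have huW := mem_supportVertices_contract h4 huv hu h1 (hbdy _ hS) (hbdne S hS)
      have hWU : insert v (supportVertices U (contract u v (S.indicator c))) ⊆ U :=
        Finset.insert_subset hv fun x hx => (mem_supportVertices.mp hx).1
      set y := S.indicator c with hy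
      set W := insert v (supportVertices U (contract u v y)) with hW
      have hspread : ∀ X : Finset V, X ∈ Z → k ≤ (X ∩ U).card → X ∩ U ⊆ W →
          ∀ x ∈ W, q x = 0 := by
        intro X hXZ hXk hXW
        refine hrig.eq_zero hgp Finset.inter_subset_right hXW hXk ?_ fun x hx =>
          hXZ x (Finset.mem_inter.mp hx).1 (Finset.mem_inter.mp hx).2
        rintro x hx z hz (⟨F, hF, hxF, hzF⟩ | ⟨rfl, rfl⟩)
        · exact hmotion x (hWU hx) z (hWU hz) ⟨F, hind S F hF, hxF, hzF⟩
        · exact hmotion x hu z hv ⟨F₀, hF₀, huF, hvF⟩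
      have hFW : ∀ F, y F ≠ 0 → F ∩ U ⊆ W := fun F hF x hx =>
        mem_insert_supportVertices h4 hF (Finset.mem_inter.mp hx).1 (Finset.mem_inter.mp hx).2
      have hBW : ∀ B, bd N y (insert u B) ≠ 0 → insert u (insert v B) ∩ U ⊆ W := by
        intro B hB x hx
        obtain ⟨hxB, hxU⟩ := Finset.mem_inter.mp hx
        obtain ⟨F, hF, hBF⟩ := (exists_face_of_bd_ne_zero hyk hB).1
        rcases Finset.mem_insert.mp hxB with rfl | hxB
        · exact Finset.mem_insert_of_mem huW
        rcases Finset.mem_insert.mp hxB with rfl | hxB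
        · exact Finset.mem_insert_self _ _
        · exact hFW F hF (Finset.mem_inter.mpr ⟨hBF (Finset.mem_insert_of_mem hxB), hxU⟩)
      refine isCoherent_of_all_or_none huv (hbdy _ hS) ?_ ?_
      · intro F hF hFZ
        have h0 := hspread F hFZ (hyk F hF) (hFW F hF)
        exact ⟨fun F' hF' x hx hxU => h0 x (hFW F' hF' (Finset.mem_inter.mpr ⟨hx, hxU⟩)),
          fun B _ _ hB x hx hxU => h0 x (hBW B hB (Finset.mem_inter.mpr ⟨hx, hxU⟩))⟩
      · intro B huB hvB hB hBZ F hF x hx hxU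
        have hcard := (exists_face_of_bd_ne_zero hyk hB).2.trans
          (le_card_insert_insert_inter huv hu hv huB hvB)
        exact hspread _ hBZ hcard (hBW B hB) x (hFW F hF (Finset.mem_inter.mpr ⟨hx, hxU⟩))
    · intro S A huA hvA hface hcontr
      have hyk : ∀ F, S.indicator c F ≠ 0 → k ≤ (F ∩ U).card := fun F hF => hck F (hind S F hF)
      have hind' := hind S
      set y := S.indicator c with hy
      rcases eq_or_ne y 0 with h0 | h0
      · rw [h0]; exact isCoherent_zero
      have hboth : y (insert u A) ≠ 0 ∧ y (insert v A) ≠ 0 := by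
        have h1 := congrFun hcontr (insert u A)
        rw [contract_insert huv huA hvA, Pi.zero_apply] at h1
        obtain ⟨F, hF⟩ := Function.ne_iff.mp h0
        rw [Pi.zero_apply] at hF
        have h2 : y (insert u A) ≠ 0 ∨ y (insert v A) ≠ 0 := by
          rcases hface F hF with rfl | rfl
          · exact Or.inl hF
          · exact Or.inr hF
        constructor
        · intro h
          rw [h, zero_add, mul_smul] at h1
          exact (h2.resolve_left (not_not.mpr h))
            (faceSign_smul_eq_zero (faceSign_smul_eq_zero h1))
        · intro h
          rw [h, smul_zero, add_zero] at h1
          exact (h2.resolve_right (not_not.mpr h)) h1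
      set K := insert u (insert v A) with hK
      have hclique : ∀ x ∈ K, ∀ z ∈ K, supportEdge c x z := by
        have hcu := hind' _ hboth.1
        have hcv := hind' _ hboth.2
        intro x hx z hz
        simp only [hK, Finset.mem_insert] at hx hz
        rcases hx with rfl | rfl | hx <;> rcases hz with rfl | rfl | hz
        · exact ⟨F₀, hF₀, huF, huF⟩
        · exact ⟨F₀, hF₀, huF, hvF⟩
        · exact ⟨_, hcu, by simp, by simp [hz]⟩
        · exact ⟨F₀, hF₀, hvF, huF⟩
        · exact ⟨F₀, hF₀, hvF, hvF⟩
        · exact ⟨_, hcv, by simp, by simp [hz]⟩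
        · exact ⟨_, hcu, by simp [hx], by simp⟩
        · exact ⟨_, hcv, by simp [hx], by simp⟩
        · exact ⟨_, hcu, by simp [hx], by simp [hz]⟩
      have hspread : ∀ X : Finset V, X ∈ Z → k ≤ (X ∩ U).card → X ⊆ K →
          ∀ x ∈ K, x ∈ U → q x = 0 := by
        intro X hXZ hXk hXK x hx hxU
        refine hgp.eq_zero_of_joined Finset.inter_subset_right hXk hxU (fun z hz =>
          hXZ z (Finset.mem_inter.mp hz).1 (Finset.mem_inter.mp hz).2) fun z hz => ?_
        exact hmotion x hxU z (Finset.mem_inter.mp hz).2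
          (hclique x hx z (hXK (Finset.mem_inter.mp hz).1))
      have hFK : ∀ F, y F ≠ 0 → F ⊆ K := by
        intro F hF
        rcases hface F hF with rfl | rfl
        · exact Finset.insert_subset_insert _ (Finset.subset_insert _ _)
        · exact Finset.subset_insert _ _
      have hBK : ∀ B, bd N y (insert u B) ≠ 0 → insert u (insert v B) ⊆ K := by
        intro B hB x hx
        obtain ⟨F, hF, hBF⟩ := (exists_face_of_bd_ne_zero hyk hB).1
        simp only [Finset.mem_insert] at hx
        rcases hx with rfl | rfl | hx
        · simp [hK]
        · simp [hK]
        · exact hFK F hF (hBF (Finset.mem_insert_of_mem hx))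
      refine isCoherent_of_all_or_none huv (by rw [← bd_contract huv huN hvN, hcontr, bd_zero])
        ?_ ?_
      · intro F hF hFZ
        have h0 := hspread F hFZ (hyk F hF) (hFK F hF)
        exact ⟨fun F' hF' x hx hxU => h0 x (hFK F' hF' hx) hxU,
          fun B _ _ hB x hx hxU => h0 x (hBK B hB hx) hxU⟩
      · intro B huB hvB hB hBZ F hF x hx hxU
        have hcard := (exists_face_of_bd_ne_zero hyk hB).2.trans
          (le_card_insert_insert_inter huv hu hv huB hvB)
        exact hspread _ hBZ hcard (hBK B hB) x (hFK F hF hx) hxU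
  rcases hmin.2 Z hbdZ with h | h
  · intro F hF
    have : Z.indicator c F ≠ 0 := by rwa [h]
    exact (Set.indicator_apply_ne_zero.mp this).1
  · have : Z.indicator c F₀ ≠ 0 := by
      rw [Set.indicator_of_mem (show F₀ ∈ Z from hF₀zero)]
      exact hF₀
    exact absurd (congrFun h F₀) this

end SimplicialChain

/-! ### Simplicial boundaries and minimal cycle complexes -/

namespace SimplicialChain

variable {V Γ : Type*} [LinearOrder V] [AddCommGroup Γ]

theorem faceSign_eq_neg_one_pow (F : Finset V) (x : V) :
    faceSign F x = (-1) ^ (F.filter (fun y => y ≤ x)).card := by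
  simp [faceSign, pairSign, Finset.prod_ite]

theorem boundary_apply {N : Finset V} (c : Finset V →₀ Γ) (hc : ∀ F ∈ c.support, F ⊆ N)
    (G : Finset V) : boundary c G = -bd N c G := by
  classical
  have h1 : boundary c G = ∑ F ∈ c.support, ∑ x ∈ F,
      if F.erase x = G then faceSign F x • c F else 0 := by
    rw [boundary, Finsupp.sum, Finsupp.finsetSum_apply]
    refine Finset.sum_congr rfl fun F _ => ?_
    rw [Finsupp.finsetSum_apply]
    refine Finset.sum_congr rfl fun x _ => ?_
    rw [Finsupp.single_apply, faceSign_eq_neg_one_pow]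
  have h2 : ∀ F ∈ c.support, (∑ x ∈ F, if F.erase x = G then faceSign F x • c F else 0) =
      ∑ x ∈ N \ G, if F = insert x G then -(faceSign G x • c (insert x G)) else 0 := by
    intro F hF
    rw [← Finset.sum_filter, ← Finset.sum_filter]
    refine Finset.sum_congr ?_ ?_
    · ext x
      simp only [Finset.mem_filter, Finset.mem_sdiff]
      constructor
      · rintro ⟨hx, rfl⟩
        exact ⟨⟨hc F hF hx, by simp⟩, (Finset.insert_erase hx).symm⟩
      · rintro ⟨⟨-, hxG⟩, rfl⟩
        exact ⟨by simp, Finset.erase_insert hxG⟩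
    · intro x hx
      simp only [Finset.mem_filter, Finset.mem_sdiff] at hx
      obtain ⟨⟨-, hxG⟩, rfl⟩ := hx
      rw [faceSign_insert hxG, pairSign, if_pos le_rfl, neg_one_mul, neg_smul]
  rw [h1, Finset.sum_congr rfl h2, Finset.sum_comm, bd, ← Finset.sum_neg_distrib]
  refine Finset.sum_congr rfl fun x _ => ?_
  rw [Finset.sum_ite_eq']
  split_ifs with h
  · rfl
  · rw [Finsupp.notMem_support_iff.mp h, smul_zero, neg_zero]

theorem boundary_eq_zero_iff {N : Finset V} (c : Finset V →₀ Γ) (hc : ∀ F ∈ c.support, F ⊆ N) :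
    boundary c = 0 ↔ bd N c = 0 := by
  rw [DFunLike.ext_iff, funext_iff]
  refine forall_congr' fun G => ?_
  rw [boundary_apply c hc, Finsupp.zero_apply, Pi.zero_apply, neg_eq_zero]

theorem IsMinimalCycle.isMinimalOn {d : ℕ} {N : Finset V} {c : Finset V →₀ Γ}
    (h : IsMinimalCycle d c) (hc : ∀ F ∈ c.support, F ⊆ N) : IsMinimalOn N c := by
  classical
  refine ⟨(boundary_eq_zero_iff c hc).mp h.1.2, fun S hS => ?_⟩
  set b : Finset V →₀ Γ := c.filter (· ∈ S) with hb
  have hbS : (b : Finset V → Γ) = S.indicator c := by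
    ext F
    simp [hb, Finsupp.filter_apply, Set.indicator_apply]
  have hsub : b.support ⊆ c.support := by
    rw [hb, Finsupp.support_filter]
    exact Finset.filter_subset _ _
  have := h.2 b (fun F => by rw [hb, Finsupp.filter_apply]; split_ifs <;> simp)
    ⟨fun F hF => h.1.1 F (hsub hF),
      (boundary_eq_zero_iff b fun F hF => hc F (hsub hF)).mpr (by rwa [hbS])⟩
  rw [← hbS]
  rcases this with h | h
  · exact Or.inl (by rw [h])
  · exact Or.inr (by rw [h]; rfl)

end SimplicialChain

namespace PreAbstractSimplicialComplex

theorem isFacet_spannedBy_iff {V : Type*} {S : Set (Finset V)} {d : ℕ} (hd : 0 < d)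
    (hS : ∀ F ∈ S, F.card = d) {F : Finset V} : (spannedBy S).IsFacet F ↔ F ∈ S := by
  constructor
  · rintro ⟨⟨hne, F', hF', hsub⟩, hmax⟩
    have : F' ⊆ F := hmax ⟨hne.mono hsub, F', hF', subset_rfl⟩ hsub
    rwa [hsub.antisymm this]
  · intro hF
    refine ⟨⟨Finset.card_pos.mp (by rw [hS F hF]; exact hd), F, hF, subset_rfl⟩, ?_⟩
    rintro G ⟨-, F', hF', hGF'⟩ hFG
    have : F = F' := Finset.eq_of_subset_of_card_le (hFG.trans hGF') (by rw [hS F hF, hS F' hF'])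
    exact this ▸ hGF'

variable {V Γ : Type*} [LinearOrder V] [AddCommGroup Γ]

/-- A minimal cycle complex is spanned by a finite nonempty family of `d`-element sets, and has
generically rigid transversal restrictions. -/
theorem IsMinimalCycleComplex.exists_family {d : ℕ} {Δ : PreAbstractSimplicialComplex V}
    (hΔ : Δ.IsMinimalCycleComplex Γ d) :
    ∃ S : Finset (Finset V), (∀ F ∈ S, F.card = d) ∧ Δ = spannedBy (S : Set (Finset V)) ∧
      ∀ (k : ℕ) (U : Finset V), 3 ≤ k → (∀ F ∈ S, k ≤ (F ∩ U).card) →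
        ∃ p : V → Fin k → ℝ, ∀ q : V → Fin k → ℝ,
          (∀ F ∈ S, ∀ x ∈ F ∩ U, ∀ y ∈ F ∩ U, (p x - p y) ⬝ᵥ (q x - q y) = 0) →
          ∃ (A : Matrix (Fin k) (Fin k) ℝ) (t : Fin k → ℝ), Aᵀ = -A ∧
            ∀ F ∈ S, ∀ x ∈ F ∩ U, q x = A *ᵥ p x + t := by
  rcases hΔ with ⟨F, hF, rfl⟩ | ⟨c, hne, hmin, rfl⟩
  · refine ⟨{F}, by simpa using hF, by simp, fun k U hk hU => ?_⟩
    obtain ⟨p, hp⟩ := (eventually_inGeneralPosition (k := k) F).exists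
    obtain ⟨A, hAF, hA⟩ := Finset.exists_subset_card_eq (hU F (by simp))
    have hAF' : A ⊆ F := hAF.trans Finset.inter_subset_left
    refine ⟨p, fun q hq => ?_⟩
    have hq' := hq F (by simp)
    obtain ⟨S, t, hS, hSt⟩ := hp.exists_trivial_motion hAF' hA (q := q)
      fun x hx y hy => hq' x (hAF hx) y (hAF hy)
    refine ⟨S, t, hS, fun F' hF' x hx => ?_⟩
    obtain rfl := Finset.mem_singleton.mp hF'
    have hmot : IsMotionOn (fun _ _ => True) (F' ∩ U) p q := fun x hx y hy _ => hq' x hx y hy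
    have h0 := hp.eq_zero_of_joined hAF' hA.ge (Finset.mem_inter.mp hx).1
      (q := fun x => q x - (S *ᵥ p x + t)) (fun y hy => sub_eq_zero.mpr (hSt y hy))
      fun y hy => hmot.sub_trivial hS t x hx y (hAF hy) trivial
    exact sub_eq_zero.mp h0
  · refine ⟨c.support, hmin.1.1, rfl, fun k U hk hU => ?_⟩
    have hsub : ∀ F ∈ c.support, F ⊆ c.support.sup id := fun F hF =>
      Finset.le_sup (f := id) hF
    obtain ⟨p, hp⟩ := (SimplicialChain.eventually_isRigidOn_of_isMinimalOn (k := k) hk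
      (c.support.sup id) U _ subset_rfl c (fun F hF => hsub F (Finsupp.mem_support_iff.mpr hF))
      (fun F hF => hU F (Finsupp.mem_support_iff.mpr hF))
      (fun h => hne (DFunLike.coe_injective h)) (hmin.isMinimalOn hsub)).exists
    refine ⟨p, fun q hq => ?_⟩
    obtain ⟨A, t, hA, hAt⟩ := hp q (by
      rintro x hx y hy ⟨F, hF, hxF, hyF⟩
      exact hq F (Finsupp.mem_support_iff.mpr hF) x
        (Finset.mem_inter.mpr ⟨hxF, (SimplicialChain.mem_supportVertices.mp hx).1⟩) y
        (Finset.mem_inter.mpr ⟨hyF, (SimplicialChain.mem_supportVertices.mp hy).1⟩))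
    refine ⟨A, t, hA, fun F hF x hx => hAt x ?_⟩
    exact SimplicialChain.mem_supportVertices.mpr
      ⟨(Finset.mem_inter.mp hx).2, F, Finsupp.mem_support_iff.mp hF, (Finset.mem_inter.mp hx).1⟩

theorem IsMinimalCycleComplex.isRigid_restrict {d : ℕ} (hd : 0 < d)
    {Δ : PreAbstractSimplicialComplex V} (hΔ : Δ.IsMinimalCycleComplex Γ d) {k : ℕ} {U : Set V}
    (hk : 3 ≤ k) (hU : Δ.IsTransversal k U) : (Δ.restrict U).graph.IsRigid k := by
  classical
  obtain ⟨S, hSd, rfl, hrigid⟩ := hΔ.exists_family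
  set U' : Finset V := (S.sup id).filter (· ∈ U) with hU'
  have hmem : ∀ F ∈ S, ∀ x, x ∈ F ∩ U' ↔ x ∈ F ∧ x ∈ U := by
    intro F hF x
    have : x ∈ F → x ∈ S.sup id := fun hx => Finset.le_sup (f := id) hF hx
    simp only [hU', Finset.mem_inter, Finset.mem_filter]
    tauto
  obtain ⟨p, hp⟩ := hrigid k U' hk fun F hF => by
    have := hU.2 F ((isFacet_spannedBy_iff hd hSd).mpr hF)
    have he : U ∩ (F : Set V) = ((F ∩ U' : Finset V) : Set V) := by
      ext x
      rw [Finset.mem_coe, hmem F hF]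
      exact and_comm
    rwa [he, Set.ncard_coe_finset] at this
  have hvert : ∀ F ∈ S, ∀ x ∈ F, x ∈ U →
      x ∈ ((spannedBy (S : Set (Finset V))).restrict U).vertexSet := fun F hF x hx hxU =>
    ⟨⟨Finset.singleton_nonempty x, F, hF, by simpa using hx⟩, by simpa using hxU⟩
  refine ⟨fun x => p x, fun q hq => ?_⟩
  obtain ⟨A, t, hA, hAt⟩ := hp (fun x => if hx : x ∈ _ then q ⟨x, hx⟩ else 0) (by
    intro F hF x hx y hy
    obtain ⟨hxF, hxU⟩ := (hmem F hF x).mp hx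
    obtain ⟨hyF, hyU⟩ := (hmem F hF y).mp hy
    rcases eq_or_ne x y with rfl | hxy
    · simp
    simp only [hvert F hF x hxF hxU, hvert F hF y hyF hyU, dif_pos]
    refine hq ⟨x, hvert F hF x hxF hxU⟩ ⟨y, hvert F hF y hyF hyU⟩ ⟨hxy, ⟨⟨x, by simp⟩, F, hF, ?_⟩, ?_⟩
    · simp [Finset.insert_subset_iff, hxF, hyF]
    · simp [Set.insert_subset_iff, hxU, hyU])
  refine ⟨A, t, hA, fun ⟨x, hx⟩ => ?_⟩
  obtain ⟨⟨-, F, hF, hxF⟩, hxU⟩ := id hx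
  have := hAt F hF x ((hmem F hF x).mpr ⟨by simpa using hxF, by simpa using hxU⟩)
  rwa [dif_pos hx] at this

/-- A facet of a `d`-coloured complex with `d`-element facets has one vertex of each colour. -/
theorem IsMinimalCycleComplex.isTransversal_colors {d : ℕ} (hd : 0 < d)
    {Δ : PreAbstractSimplicialComplex V} (hΔ : Δ.IsMinimalCycleComplex Γ d)
    (κ : Δ.graph.Coloring (Fin d)) (T : Finset (Fin d)) :
    Δ.IsTransversal T.card {v | ∃ hv : v ∈ Δ.vertexSet, κ ⟨v, hv⟩ ∈ T} := by
  refine ⟨fun v hv => hv.1, fun F hF => ?_⟩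
  have hcard : F.card = d := by
    obtain ⟨S, hSd, rfl, -⟩ := hΔ.exists_family
    exact hSd F ((isFacet_spannedBy_iff hd hSd).mp hF)
  have hface : ∀ G ⊆ F, G.Nonempty → G ∈ Δ.faces := fun G hG hne =>
    (Δ.isRelLowerSet_faces hF.1).2 hG hne
  have hvert : ∀ x : F, (x : V) ∈ Δ.vertexSet := fun x =>
    hface _ (by simp) (Finset.singleton_nonempty _)
  let f : F → Fin d := fun x => κ ⟨x, hvert x⟩
  have hinj : Function.Injective f := by
    intro x y hxy
    by_contra hne
    have hne' : (x : V) ≠ y := fun h => hne (Subtype.ext h)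
    exact κ.valid (v := ⟨x, hvert x⟩) (w := ⟨y, hvert y⟩) ⟨hne', hface _ (by
      simp [Finset.insert_subset_iff]) ⟨x, by simp⟩⟩ hxy
  have hsurj : Function.Surjective f :=
    ((Fintype.bijective_iff_injective_and_card f).mpr ⟨hinj, by simp [hcard]⟩).2
  choose g hg using hsurj
  have hginj : Function.Injective fun i => (g i : V) :=
    Subtype.val_injective.comp (Function.LeftInverse.injective (g := f) hg)
  rw [← Finset.card_image_of_injective T hginj, ← Set.ncard_coe_finset]
  refine Set.ncard_le_ncard ?_ ((F.finite_toSet).inter_of_right _)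
  intro x hx
  obtain ⟨i, hi, rfl⟩ := Finset.mem_image.mp hx
  refine ⟨⟨hvert _, ?_⟩, (g i).2⟩
  have : κ ⟨g i, hvert _⟩ = i := hg i
  rwa [this]

end PreAbstractSimplicialComplex

theorem theorem4p1 {V : Type*} [LinearOrder V] {Γ : Type*} [AddCommGroup Γ]
    (d : ℕ) (hd : 3 ≤ d) (Δ : PreAbstractSimplicialComplex V)
    (hΔ : Δ.IsMinimalCycleComplex Γ d) :
    (∀ (κ : Δ.graph.Coloring (Fin d)) (T : Finset (Fin d)), 3 ≤ T.card →
      (Δ.rankSelected κ T).graph.IsRigid T.card) ∧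
    (∀ (k : ℕ) (U : Set V), 3 ≤ k → k ≤ d → Δ.IsTransversal k U →
      (Δ.restrict U).graph.IsRigid k) := by
  have hd' : 0 < d := by omega
  exact ⟨fun κ T hT => hΔ.isRigid_restrict hd' hT (hΔ.isTransversal_colors hd' κ T),
    fun k U hk _ hU => hΔ.isRigid_restrict hd' hk hU⟩
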